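/- Let $\mathbb{A}$ be a finite alphabet. A finite word $u=a_1\cdots a_k\in\mathbb{A}^*$ (possibly empty) is viewed as a relational structure whose universe is the set of its positions $\{1,\dots,k\}$, with the order $\le$ on positions and, for each letter $a\in\mathbb{A}$, the unary predicate "position $i$ carries the letter $a$". Formulae of cost monadic logic over words use monadic variables $X,Y,\dots$, which range over sets of positions, and a single bound variable $N$, which ranges over $\mathbb{N}$. They are given by the grammar $$R(X_1,\dots,X_n)\ \mid\ \neg R(X_1,\dots,X_n)\ \mid\ |X|\le N\ \mid\ \varphi\wedge\psi\ \mid\ \varphi\vee\psi\ \mid\ \exists X.\,\varphi\ \mid\ \forall X.\,\varphi ,$$ where $R$ is the inclusion $X\subseteq Y$, the order $X\le Y$ (which holds iff $X=\{i\}$ and $Y=\{j\}$ with $i\le j$), or a letter predicate $a(X)$ (which holds iff $X=\{i\}$ and position $i$ carries $a$). In particular $|X|\le N$ is never negated. A sentence is a formula without free monadic variables (it may use $N$). A monadic sentence is a sentence that does not use $|X|\le N$. For a sentence $\varphi$ and a word $u$ put $$[\![\varphi]\!](u)=\inf\{n\in\mathbb{N} : u,n\models\varphi\}\in\mathbb{N}\cup\{\infty\},$$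 where $u,n\models\varphi$ means that $\varphi$ is true in $u$ when $N$ takes the value $n$, and $\inf\emptyset=\infty$. For $f,g:\mathbb{A}^*\to\mathbb{N}\cup\{\infty\}$ write $f\preccurlyeq g$ ($f$ is dominated by $g$) if there is a non-decreasing $\alpha:\mathbb{N}\to\mathbb{N}$ with $\alpha(n)\ge n$ for all $n$ such that $f(u)\le\alpha(g(u))$ for all $u$, where $\alpha(\infty)=\infty$. Call $f$ bounded over a set $S$ of words if there is $n\in\mathbb{N}$ with $f(u)\le n$ for all $u\in S$. Theorem. The following problems are decidable, where formulae are given as strings of symbols. 1. (Domination) Given sentences $\varphi,\psi$ of cost monadic logic, does $[\![\varphi]\!]\preccurlyeq[\![\psi]\!]$ hold? 2. (Boundedness) Given a sentence $\varphi$, is $[\![\varphi]\!]$ bounded over $\mathbb{A}^*$? 3. (Boundedness over a regular language) Given a sentence $\varphi$ and a monadic sentence $\chi$, is $[\![\varphi]\!]$ bounded over the set of words that satisfy $\chi$? 4. (Limitedness) Given a sentence $\varphi$, is $[\![\varphi]\!]$ bounded over $\{u\in\mathbb{A}^* : [\![\varphi]\!](u)\ne\infty\}$? 5. (Divergence) Given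 a sentence $\varphi$, is $\{u\in\mathbb{A}^* : [\![\varphi]\!](u)\le n\}$ finite for every $n\in\mathbb{N}$? -/

import Mathlib

namespace CostMSO

/-! ### Syntax: only monadic variables (indexed by `ℕ`), negations at the leaves -/

/-- Atomic formulae `R(X₁,…,Xₙ)` over the signature of words over the alphabet `A`: inclusion,
the order on positions, and one unary predicate for every letter. -/
inductive Atom (A : Type*) where
  | incl (X Y : ℕ)
  | le (X Y : ℕ)
  | letter (a : A) (X : ℕ)

/-- Formulae of cost monadic logic over words. The predicate `|X| ≤ N` (`cardLe X`) cannot be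
negated. -/
inductive Formula (A : Type*) where
  | pos (R : Atom A)
  | neg (R : Atom A)
  | cardLe (X : ℕ)
  | and (φ ψ : Formula A)
  | or (φ ψ : Formula A)
  | ex (X : ℕ) (φ : Formula A)
  | all (X : ℕ) (φ : Formula A)

variable {A : Type*}

/-- The variables of an atomic formula. -/
def Atom.vars : Atom A → Finset ℕ
  | .incl X Y => {X, Y}
  | .le X Y => {X, Y}
  | .letter _ X => {X}

/-- The free monadic variables. -/
def Formula.freeVars : Formula A → Finset ℕ
  | .pos R => R.vars
  | .neg R => R.vars
  | .cardLe X => {X}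
  | .and φ ψ => φ.freeVars ∪ ψ.freeVars
  | .or φ ψ => φ.freeVars ∪ ψ.freeVars
  | .ex X φ => φ.freeVars.erase X
  | .all X φ => φ.freeVars.erase X

/-- Formulae of (ordinary) monadic logic: those that do not use `|X| ≤ N`. -/
def Formula.IsMonadic : Formula A → Prop
  | .pos _ => True
  | .neg _ => True
  | .cardLe _ => False
  | .and φ ψ => φ.IsMonadic ∧ ψ.IsMonadic
  | .or φ ψ => φ.IsMonadic ∧ ψ.IsMonadic
  | .ex _ φ => φ.IsMonadic
  | .all _ φ => φ.IsMonadic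

/-- Sentences of cost monadic logic: no free monadic variable. -/
abbrev Sentence (A : Type*) : Type _ := {φ : Formula A // φ.freeVars = ∅}

/-- Sentences of monadic logic. -/
abbrev MonadicSentence (A : Type*) : Type _ :=
  {φ : Formula A // φ.freeVars = ∅ ∧ φ.IsMonadic}

/-! ### Semantics over finite words -/

/-- Valuations of the monadic variables by sets of positions of the word `u`. -/
abbrev Valuation (u : List A) : Type := ℕ → Set (Fin u.length)

/-- Truth of atomic formulae. The relations over positions are raised to singleton sets. -/
def Atom.Holds (u : List A) (ν : Valuation u) : Atom A → Prop
  | .incl X Y => ν X ⊆ ν Y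
  | .le X Y => ∃ i j : Fin u.length, ν X = {i} ∧ ν Y = {j} ∧ i ≤ j
  | .letter a X => ∃ i : Fin u.length, ν X = {i} ∧ u.get i = a

/-- `Sat u n φ ν` is `u, ν, n ⊨ φ`: the word `u` satisfies `φ` when the free variables are
interpreted by `ν` and the bound variable `N` by `n`. -/
def Sat (u : List A) (n : ℕ) : Formula A → Valuation u → Prop
  | .pos R, ν => R.Holds u ν
  | .neg R, ν => ¬ R.Holds u ν
  | .cardLe X, ν => (ν X).encard ≤ n
  | .and φ ψ, ν => Sat u n φ ν ∧ Sat u n ψ ν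
  | .or φ ψ, ν => Sat u n φ ν ∨ Sat u n ψ ν
  | .ex X φ, ν => ∃ E : Set (Fin u.length), Sat u n φ (Function.update ν X E)
  | .all X φ, ν => ∀ E : Set (Fin u.length), Sat u n φ (Function.update ν X E)

/-- The value `inf {n | u, ν, n ⊨ φ}` in `ℕ ∪ {∞}`. -/
noncomputable def Formula.value (φ : Formula A) (u : List A) (ν : Valuation u) : ℕ∞ :=
  ⨅ (n : ℕ) (_ : Sat u n φ ν), (n : ℕ∞)

/-- The function computed by a sentence over words. A sentence has no free variable, so the
valuation is irrelevant; we take the one that is constantly empty. -/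
noncomputable def Sentence.value (φ : Sentence A) (u : List A) : ℕ∞ :=
  φ.1.value u (fun _ => ∅)

/-- The language of the words that satisfy a monadic sentence (neither the valuation nor the
value of the bound variable matters). -/
def MonadicSentence.models (χ : MonadicSentence A) : Set (List A) :=
  {u | Sat u 0 χ.1 (fun _ => ∅)}

/-! ### Domination and bounds -/

/-- Correction functions. -/
def IsCorrection (α : ℕ → ℕ) : Prop := Monotone α ∧ ∀ n, n ≤ α n

/-- The extension of `α` to `ℕ ∪ {∞}` with value `∞` at `∞`. -/
def extend (α : ℕ → ℕ) (x : ℕ∞) : ℕ∞ :=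
  ENat.recTopCoe ⊤ (fun n => ((α n : ℕ) : ℕ∞)) x

/-- `f ≼ g`: there is a correction function `α` with `f ≤ extend α ∘ g`. -/
def Dominated {E : Type*} (f g : E → ℕ∞) : Prop :=
  ∃ α : ℕ → ℕ, IsCorrection α ∧ ∀ x, f x ≤ extend α (g x)

/-- `f` is bounded over the set `S`. -/
def BoundedOver {E : Type*} (f : E → ℕ∞) (S : Set E) : Prop :=
  ∃ n : ℕ, ∀ x ∈ S, f x ≤ n

/-- `f` diverges: every sublevel set is finite. -/
def Diverges {E : Type*} (f : E → ℕ∞) : Prop :=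
  ∀ n : ℕ, {x | f x ≤ n}.Finite

/-! ### Decision problems -/

/-- The symbols of written formulae: a tag for the constructor and at most two parameters
(names of variables or letters). -/
abbrev Token : Type := ℕ × ℕ × ℕ

/-- The token of an atomic formula, with tags starting at `t`. -/
def Atom.token [Encodable A] (t : ℕ) : Atom A → Token
  | .incl X Y => (t, X, Y)
  | .le X Y => (t + 1, X, Y)
  | .letter a X => (t + 2, Encodable.encode a, X)

/-- A formula written in prefix notation. -/
def Formula.code [Encodable A] : Formula A → List Token
  | .pos R => [R.token 0]
  | .neg R => [R.token 3]
  | .cardLe X => [(6, X, 0)]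
  | .and φ ψ => (7, 0, 0) :: (φ.code ++ ψ.code)
  | .or φ ψ => (8, 0, 0) :: (φ.code ++ ψ.code)
  | .ex X φ => (9, X, 0) :: φ.code
  | .all X φ => (10, X, 0) :: φ.code

/-- A decision problem `P` on the instances `I`, presented to the algorithm by `code`, is
decidable: some computable Boolean function gives the right answer on every instance. -/
def DecidableProblem {I C : Type*} [Primcodable C] (code : I → C) (P : I → Prop) : Prop :=
  ∃ d : C → Bool, Computable d ∧ ∀ i, d (code i) = true ↔ P i

end CostMSO

namespace CostMSO

/-! All five problems reduce to domination. Boundedness over `S` is domination by a function that is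
`0` on `S` and `∞` elsewhere: a true sentence, a monadic sentence or, for limitedness, `φ` with
every `|X| ≤ N` made true, which holds exactly where `⟦φ⟧` is finite. Divergence says that `⟦φ⟧`
dominates the length, since the alphabet is finite.

Domination is decided with finite monoids that carry a stabilisation `e ↦ e♯` on idempotents. A word
is evaluated along a factorisation tree, made of binary products and of nodes with more than `c`
children of one idempotent value `e`, which get the value `e♯`. The value may depend on the tree.
`Recognises` only asks for two bounds: for some fixed threshold, an accepted tree of height `H`
bounds `⟦φ⟧` in terms of `H`; and for every `n` there is a threshold for which all trees, of any
height, over a word with `⟦φ⟧ ≤ n` are accepted.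

Every formula has such an algebra. Atoms use ordinary monoids, `|X| ≤ N` uses the values zero, one
and many, connectives use products, and quantifiers use power sets. In a power set, `S♯` collects
the values of long products of elements of `S`; `Pow.exists_lift` and `Pow.exists_proj` move trees
between a word and its projection. The existence of trees of bounded height for each threshold
(`exists_tree`) is a form of Simon's factorisation theorem, proved by descending through the
two-sided ideals.

The elements in the closure of the letters under products and stabilisation are values of trees
whose height stays fixed while the threshold grows; conversely every tree of finite height takes its
value there. Hence domination holds iff no element of this closure in the product algebra is
accepted for `ψ` and rejected for `φ`, with the unit checked separately for the empty word
(`dominated_value_iff`). The algebras are finite and are computed from the formula as tables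
(`exists_recognises`), by a primitive recursive procedure. -/

/-- A monoid with a stabilisation operator, meaningful on idempotents. -/
class SharpMonoid (M : Type) extends Monoid M where
  sharp : M → M
  mul_sharp : ∀ e : M, e * e = e → e * sharp e = sharp e
  sharp_mul : ∀ e : M, e * e = e → sharp e * e = sharp e
  sharp_mul_sharp : ∀ e : M, e * e = e → sharp e * sharp e = sharp e

open SharpMonoid

/-- `Tree c H l a`: the list `l` evaluates to `a` by a factorisation tree of height at most `H`
with binary product nodes and stabilisation nodes with more than `c` children, all of them
with the same idempotent value. -/
inductive Tree {M : Type} [SharpMonoid M] (c : ℕ) : ℕ∞ → List M → M → Prop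
  | leaf (H : ℕ∞) (a : M) : Tree c H [a] a
  | mul {H H' : ℕ∞} {u v : List M} {a b : M} :
      Tree c H u a → Tree c H v b → H + 1 ≤ H' → Tree c H' (u ++ v) (a * b)
  | stab {H H' : ℕ∞} {us : List (List M)} {e : M} : e * e = e → c < us.length →
      (∀ u ∈ us, Tree c H u e) → H + 1 ≤ H' → Tree c H' us.flatten (sharp e)

/-! ### Factorisation trees: monotonicity, images and grafting -/

section Trees

variable {M : Type} [SharpMonoid M] {c : ℕ} {H K : ℕ∞}

theorem Tree.mono {l : List M} {a : M} (h : Tree c H l a) (hK : H ≤ K) : Tree c K l a := by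
  cases h with
  | leaf => exact .leaf _ _
  | mul h₁ h₂ h₃ => exact .mul h₁ h₂ (h₃.trans hK)
  | stab h₁ h₂ h₃ h₄ => exact .stab h₁ h₂ h₃ (h₄.trans hK)

theorem Tree.anti {c' : ℕ} {l : List M} {a : M} (h : Tree c H l a) (hc : c' ≤ c) :
    Tree c' H l a := by
  induction h with
  | leaf => exact .leaf _ _
  | mul _ _ h₃ i₁ i₂ => exact .mul i₁ i₂ h₃
  | stab h₁ h₂ _ h₄ i => exact .stab h₁ (hc.trans_lt h₂) i h₄

theorem Tree.ne_nil {l : List M} {a : M} (h : Tree c H l a) : l ≠ [] := by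
  induction h with
  | leaf => simp
  | mul _ _ _ i₁ _ => simp [i₁]
  | @stab _ _ us _ _ h₂ _ _ i =>
    obtain ⟨u, hu⟩ := List.exists_mem_of_length_pos (l := us) (by omega)
    intro h
    exact i u hu (List.flatten_eq_nil_iff.1 h u hu)

theorem Tree.map {N : Type} [SharpMonoid N] (f : M → N) (hmul : ∀ x y, f (x * y) = f x * f y)
    (hsh : ∀ x, f (sharp x) = sharp (f x)) {l : List M} {a : M} (h : Tree c H l a) :
    Tree c H (l.map f) (f a) := by
  induction h with
  | leaf => exact .leaf _ _
  | mul _ _ h₃ i₁ i₂ => rw [List.map_append, hmul]; exact .mul i₁ i₂ h₃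
  | @stab _ _ us e h₁ h₂ _ h₄ i =>
    rw [List.map_flatten, hsh]
    refine .stab (by rw [← hmul, h₁]) (by simpa using h₂) ?_ h₄
    intro u hu
    obtain ⟨u', hu', rfl⟩ := List.mem_map.1 hu
    exact i u' hu'

theorem forall₂_append_right {α β : Type*} {R : α → β → Prop} :
    ∀ {u v : List β} {l : List α}, List.Forall₂ R l (u ++ v) →
      ∃ l₁ l₂, l = l₁ ++ l₂ ∧ List.Forall₂ R l₁ u ∧ List.Forall₂ R l₂ v
  | [], _, l, h => ⟨[], l, rfl, .nil, h⟩
  | _ :: _, _, _, h => by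
    cases h with
    | cons h₁ h₂ =>
      obtain ⟨l₁, l₂, rfl, h₃, h₄⟩ := forall₂_append_right h₂
      exact ⟨_ :: l₁, l₂, rfl, .cons h₁ h₃, h₄⟩

theorem forall₂_flatten_right {α β : Type*} {R : α → β → Prop} :
    ∀ {us : List (List β)} {l : List α}, List.Forall₂ R l us.flatten →
      ∃ ls, l = ls.flatten ∧ List.Forall₂ (List.Forall₂ R) ls us
  | [], l, h => ⟨[], by cases h; rfl, .nil⟩
  | _ :: _, _, h => by
    obtain ⟨l₁, l₂, rfl, h₁, h₂⟩ := forall₂_append_right (by simpa using h)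
    obtain ⟨ls, rfl, h₃⟩ := forall₂_flatten_right h₂
    exact ⟨l₁ :: ls, rfl, .cons h₁ h₃⟩

theorem forall₂_flatten {α β : Type*} {R : α → β → Prop} {ls : List (List α)}
    {us : List (List β)} (h : List.Forall₂ (List.Forall₂ R) ls us) :
    List.Forall₂ R ls.flatten us.flatten := by
  induction h with
  | nil => exact .nil
  | cons h₁ _ ih => simpa using List.rel_append h₁ ih

theorem forall₂_exists_left {α β : Type*} {R : α → β → Prop} {l : List α} {l' : List β}
    (h : List.Forall₂ R l l') {x : α} (hx : x ∈ l) : ∃ y ∈ l', R x y := by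
  induction h with
  | nil => simp at hx
  | cons h₁ _ ih =>
    rcases List.mem_cons.1 hx with rfl | hx
    · exact ⟨_, by simp, h₁⟩
    · obtain ⟨y, hy, h⟩ := ih hx
      exact ⟨y, by simp [hy], h⟩

theorem forall₂_choose {α β : Type*} {R : α → β → Prop} :
    ∀ {l' : List β}, (∀ y ∈ l', ∃ x, R x y) → ∃ l, List.Forall₂ R l l'
  | [], _ => ⟨[], .nil⟩
  | y :: l', h => by
    obtain ⟨x, hx⟩ := h y (by simp)
    obtain ⟨l, hl⟩ := forall₂_choose (l' := l') fun z hz => h z (by simp [hz])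
    exact ⟨x :: l, .cons hx hl⟩

/-- Trees may be grafted on the leaves of a tree. -/
theorem Tree.subst {xs : List M} {a : M} (h : Tree c H xs a) :
    ∀ {ls : List (List M)}, List.Forall₂ (Tree c K) ls xs → Tree c (K + H) ls.flatten a := by
  induction h with
  | leaf H a =>
    intro ls hls
    cases hls with
    | cons h₁ h₂ => cases h₂; simpa using h₁.mono le_self_add
  | mul _ _ h₃ i₁ i₂ =>
    intro ls hls
    obtain ⟨l₁, l₂, rfl, h₁, h₂⟩ := forall₂_append_right hls
    rw [List.flatten_append]
    exact .mul (i₁ h₁) (i₂ h₂) (by rw [add_assoc]; gcongr)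
  | stab h₁ h₂ _ h₄ i =>
    intro ls hls
    obtain ⟨ls, rfl, h⟩ := forall₂_flatten_right hls
    rw [List.flatten_flatten]
    refine .stab h₁ (by simpa [h.length_eq] using h₂) ?_ (by rw [add_assoc]; gcongr)
    intro u hu
    obtain ⟨v, hv, rfl⟩ := List.mem_map.1 hu
    obtain ⟨y, hy, hR⟩ := forall₂_exists_left h hv
    exact i y hy hR

theorem forall₂_tree_subst {m n : ℕ} {ms : List (List (List M))} {ks : List (List M)}
    {z : List M} (h₁ : List.Forall₂ (List.Forall₂ (Tree c m)) ms ks)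
    (h₂ : List.Forall₂ (Tree c n) ks z) :
    List.Forall₂ (Tree c (m + n : ℕ)) (ms.map List.flatten) z := by
  induction h₂ generalizing ms with
  | nil => cases h₁; exact .nil
  | cons h _ ih =>
    cases h₁ with
    | cons h₃ h₄ => exact .cons (by rw [Nat.cast_add]; exact h.subst h₃) (ih h₄)

/-- `Tree` has no node that sends many copies of `e` to `e` itself. A chain of binary nodes does it,
at a height linear in the number of blocks, and is only affordable below the threshold. -/
theorem Tree.replicate {e : M} (he : e * e = e) :
    ∀ {us : List (List M)}, us ≠ [] → (∀ u ∈ us, Tree c H u e) →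
      Tree c (H + us.length) us.flatten e
  | [], h, _ => (h rfl).elim
  | [u], _, h => by simpa using (h u (by simp)).mono le_self_add
  | u :: v :: us, _, h => by
    have := Tree.replicate he (us := v :: us) (by simp) fun x hx => h x (by simp [hx])
    rw [List.flatten_cons]
    have key := Tree.mul ((h u (by simp)).mono le_self_add) this
      (H' := H + (u :: v :: us).length) (by
        simp only [List.length_cons, Nat.cast_add, Nat.cast_one, add_assoc]; exact le_rfl)
    rwa [he] at key

end Trees

/-! ### Existence of factorisation trees of bounded height -/

section Factorisation

variable {M : Type} [SharpMonoid M] [Finite M]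

/-- The cardinality of the two-sided ideal generated by `x`. -/
noncomputable def idealCard (x : M) : ℕ := {y | ∃ u v, u * x * v = y}.ncard

theorem idealCard_mul_mul_le (u x v : M) : idealCard (u * x * v) ≤ idealCard x := by
  refine Set.ncard_le_ncard ?_ (Set.toFinite _)
  rintro _ ⟨a, b, rfl⟩
  exact ⟨a * u, v * b, by simp only [mul_assoc]⟩

theorem idealCard_mul_le_left (x v : M) : idealCard (x * v) ≤ idealCard x := by
  simpa using idealCard_mul_mul_le 1 x v

theorem idealCard_mul_le_right (u x : M) : idealCard (u * x) ≤ idealCard x := by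
  simpa using idealCard_mul_mul_le u x 1

theorem idealCard_pos (x : M) : 0 < idealCard x :=
  (Set.ncard_pos (Set.toFinite _)).2 ⟨x, 1, 1, by simp⟩

theorem exists_of_idealCard_eq {x y : M} (hy : ∃ u v, u * x * v = y)
    (h : idealCard x ≤ idealCard y) : ∃ u v, u * y * v = x := by
  obtain ⟨a, b, rfl⟩ := hy
  have := Set.eq_of_subset_of_ncard_le (s := {z | ∃ u v, u * (a * x * b) * v = z})
    (t := {z | ∃ u v, u * x * v = z}) ?_ h (Set.toFinite _)
  · have h1 : x ∈ {z | ∃ u v, u * x * v = z} := ⟨1, 1, by simp⟩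
    rwa [← this] at h1
  · rintro _ ⟨u, v, rfl⟩
    exact ⟨u * a, b * v, by simp only [mul_assoc]⟩

/-- Stability of finite monoids, on the left. -/
theorem exists_mul_eq_of_idealCard_le {p x : M} (h : idealCard x ≤ idealCard (p * x)) :
    ∃ q, q * (p * x) = x := by
  obtain ⟨u, v, hx⟩ := exists_of_idealCard_eq (y := p * x) ⟨p, 1, by simp⟩ h
  have := Set.eq_of_subset_of_ncard_le (s := Set.range fun q => q * (p * x))
    (t := Set.range fun q => q * x) ?_ ?_ (Set.toFinite _)
  · have h1 : x ∈ Set.range fun q => q * x := ⟨1, by simp⟩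
    rwa [← this] at h1
  · rintro _ ⟨q, rfl⟩
    exact ⟨q * p, by simp only [mul_assoc]⟩
  -- As `x = u * (p * x) * v`, right multiplication by `v` sends the left ideal of `p * x` onto a
  -- superset of that of `x`; the converse inclusion of ideals and finiteness force equality.
  · have hsub : (Set.range fun q => q * x) ⊆ (· * v) '' Set.range fun q => q * (p * x) := by
      rintro _ ⟨q, rfl⟩
      exact ⟨q * u * (p * x), ⟨q * u, rfl⟩, by
        conv_rhs => rw [← hx]
        simp only [mul_assoc]⟩
    exact (Set.ncard_le_ncard hsub (Set.toFinite _)).trans (Set.ncard_image_le (Set.toFinite _))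

/-- Stability of finite monoids, on the right. -/
theorem exists_eq_mul_of_idealCard_le {p x : M} (h : idealCard x ≤ idealCard (x * p)) :
    ∃ q, x * p * q = x := by
  obtain ⟨u, v, hx⟩ := exists_of_idealCard_eq (y := x * p) ⟨1, p, by simp⟩ h
  have := Set.eq_of_subset_of_ncard_le (s := Set.range fun q => x * p * q)
    (t := Set.range fun q => x * q) ?_ ?_ (Set.toFinite _)
  · have h1 : x ∈ Set.range fun q => x * q := ⟨1, by simp⟩
    rwa [← this] at h1
  · rintro _ ⟨q, rfl⟩
    exact ⟨p * q, by simp only [mul_assoc]⟩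
  · have hsub : (Set.range fun q => x * q) ⊆ (u * ·) '' Set.range fun q => x * p * q := by
      rintro _ ⟨q, rfl⟩
      exact ⟨x * p * (v * q), ⟨v * q, rfl⟩, by
        conv_rhs => rw [← hx]
        simp only [mul_assoc]⟩
    exact (Set.ncard_le_ncard hsub (Set.toFinite _)).trans (Set.ncard_image_le (Set.toFinite _))

/-- Stability writes `e = q * e♯`, and `e♯ * e♯ = e♯` then gives `e * e♯ = e`, whereas `e * e♯ =
e♯`. So a stabilisation that changes `e` strictly shrinks its ideal; this drives the descent. -/
theorem sharp_eq_of_idealCard_le {e : M} (he : e * e = e)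
    (h : idealCard e ≤ idealCard (sharp e)) : sharp e = e := by
  obtain ⟨q, hq⟩ := exists_mul_eq_of_idealCard_le (p := sharp e) (x := e)
    (by rwa [sharp_mul e he])
  rw [sharp_mul e he] at hq
  have : e * sharp e = e := by
    have h2 : q * sharp e * sharp e = e := by rw [mul_assoc, sharp_mul_sharp e he, hq]
    rwa [hq] at h2
  rw [← mul_sharp e he, this]

end Factorisation

/-! ### Trees of bounded height by descent through the ideals -/

section Progress

variable {M : Type} [SharpMonoid M]

/-- `l` evaluates to its product, or a nonempty prefix of `l` evaluates to an element with
a two-sided ideal smaller than `δ`. -/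
def Progress (c δ : ℕ) (H : ℕ∞) (l : List M) : Prop :=
  Tree c H l l.prod ∨ ∃ u v a, l = u ++ v ∧ Tree c H u a ∧ idealCard a < δ

variable {c δ : ℕ} {H K : ℕ∞}

theorem Progress.mono {l : List M} (h : Progress c δ H l) (hK : H ≤ K) : Progress c δ K l := by
  rcases h with h | ⟨u, v, a, rfl, h, ha⟩
  · exact .inl (h.mono hK)
  · exact .inr ⟨u, v, a, rfl, h.mono hK, ha⟩

theorem prod_flatten_of_idempotent {e : M} (he : e * e = e) :
    ∀ {us : List (List M)}, us ≠ [] → (∀ u ∈ us, u.prod = e) → us.flatten.prod = e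
  | [], h, _ => (h rfl).elim
  | [u], _, h => by simpa using h
  | u :: v :: us, _, h => by
    rw [List.flatten_cons, List.prod_append, h u (by simp),
      prod_flatten_of_idempotent he (us := v :: us) (by simp) fun x hx => h x (by simp [hx]), he]

/-- The labels of the inner cuts of `w`, read with context `P` on the left and `S` on the right,
are in `Λ`. -/
def CutsIn (P S : M) (w : List M) (Λ : Set (M × M)) : Prop :=
  ∀ u v, w = u ++ v → u ≠ [] → v ≠ [] → (P * u.prod, v.prod * S) ∈ Λ

theorem CutsIn.left {P S : M} {u v : List M} {Λ : Set (M × M)} (h : CutsIn P S (u ++ v) Λ) :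
    CutsIn P (v.prod * S) u Λ := by
  rintro u₁ u₂ rfl h₁ h₂
  simpa [mul_assoc] using h u₁ (u₂ ++ v) (by simp) h₁ (by simp [h₂])

theorem CutsIn.right {P S : M} {u v : List M} {Λ : Set (M × M)} (h : CutsIn P S (u ++ v) Λ) :
    CutsIn (P * u.prod) S v Λ := by
  rintro v₁ v₂ rfl h₁ h₂
  simpa [mul_assoc] using h (u ++ v₁) v₂ (by simp) (by simp [h₁]) h₂

/-- The first cut with a new label. -/
theorem CutsIn.first {P S p s : M} {w : List M} {Λ : Set (M × M)}
    (h : CutsIn P S w (insert (p, s) Λ)) (hw : ¬ CutsIn P S w Λ) :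
    ∃ u v, w = u ++ v ∧ u ≠ [] ∧ v ≠ [] ∧ P * u.prod = p ∧ v.prod * S = s ∧ CutsIn P s u Λ := by
  have hex : ∃ n, ∃ u v, u.length = n ∧ w = u ++ v ∧ u ≠ [] ∧ v ≠ [] ∧
      (P * u.prod, v.prod * S) = (p, s) := by
    by_contra hcon
    push Not at hcon
    refine hw fun u v h₁ h₂ h₃ => ?_
    exact (h u v h₁ h₂ h₃).resolve_left (hcon _ u v rfl h₁ h₂ h₃)
  classical
  obtain ⟨u, v, hn, rfl, h₂, h₃, h₄⟩ := Nat.find_spec hex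
  obtain ⟨h₅, h₆⟩ := Prod.mk.inj h₄
  refine ⟨u, v, rfl, h₂, h₃, h₅, h₆, ?_⟩
  rintro u₁ u₂ rfl hu₁ hu₂
  have hmem := h u₁ (u₂ ++ v) (by simp) hu₁ (by simp [hu₂])
  rw [List.prod_append, mul_assoc, h₆] at hmem
  refine hmem.resolve_left fun heq => ?_
  refine Nat.find_min hex (m := u₁.length) ?_
    ⟨u₁, u₂ ++ v, rfl, by simp, hu₁, by simp [hu₂], by rw [List.prod_append, mul_assoc, h₆, heq]⟩
  rw [← hn]
  have := List.length_pos_iff.2 hu₂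
  simp; omega

/-- A factor that starts at a cut labelled `(p, s)` is split at all such cuts. -/
theorem CutsIn.split {p s S : M} {Λ : Set (M × M)} (n : ℕ) :
    ∀ w : List M, w.length ≤ n → w ≠ [] → w.prod * S = s → CutsIn p S w (insert (p, s) Λ) →
      ∃ (B : List (List M)) (z : List M), w = B.flatten ++ z ∧ z ≠ [] ∧ CutsIn p S z Λ ∧
        ∀ b ∈ B, b ≠ [] ∧ p * b.prod = p ∧ b.prod * s = s ∧ CutsIn p s b Λ := by
  induction n with
  | zero => exact fun w h hne => (hne (List.length_eq_zero_iff.1 (by omega))).elim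
  | succ n ih =>
    intro w hn hne hw h
    by_cases hΛ : CutsIn p S w Λ
    · exact ⟨[], w, by simp, hne, hΛ, by simp⟩
    · obtain ⟨u, v, rfl, hu, hv, hp, hs, hcut⟩ := h.first hΛ
      have hlen := List.length_pos_iff.2 hu
      have hr := h.right
      rw [hp] at hr
      obtain ⟨B, z, rfl, hz, hcz, hB⟩ := ih v (by simp at hn; omega) hv hs hr
      refine ⟨u :: B, z, by simp, hz, hcz, ?_⟩
      simp only [List.mem_cons, forall_eq_or_imp]
      refine ⟨⟨hu, hp, ?_, hcut⟩, hB⟩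
      rw [List.prod_append, mul_assoc, hs] at hw
      exact hw

variable [Finite M]

/-- A small ideal stays small under multiplication, so a drop inside `v` survives when the value of
`u` is put in front. -/
theorem Progress.append {u v : List M} (hu : Progress c δ H u) (hv : Progress c δ H v) :
    Progress c δ (H + 1) (u ++ v) := by
  rcases hu with hu | ⟨u₁, u₂, a, rfl, h, ha⟩
  · rcases hv with hv | ⟨v₁, v₂, a, rfl, h, ha⟩
    · exact .inl (by rw [List.prod_append]; exact .mul hu hv le_rfl)
    · exact .inr ⟨u ++ v₁, v₂, u.prod * a, by simp, .mul hu h le_rfl,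
        (idealCard_mul_le_right _ _).trans_lt ha⟩
  · exact .inr ⟨u₁, u₂ ++ v, a, by simp, h.mono le_self_add, ha⟩

/-- Up to `c` blocks are multiplied by binary nodes. More blocks are stabilised, and then either `e♯
= e` is the product or the ideal of `e♯` is strictly smaller. -/
theorem Progress.replicate {e : M} (he : e * e = e) (hδ : idealCard e ≤ δ)
    {us : List (List M)} (hne : us ≠ []) (hus : ∀ u ∈ us, Tree c H u u.prod)
    (hprod : ∀ u ∈ us, u.prod = e) :
    Progress c δ (H + (c + 1 : ℕ)) us.flatten := by
  have htree : ∀ u ∈ us, Tree c H u e := fun u hu => by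
    have := hus u hu
    rwa [hprod u hu] at this
  have hp := prod_flatten_of_idempotent he hne hprod
  by_cases hc : c < us.length
  · have h := Tree.stab he hc htree (H' := H + (c + 1 : ℕ)) (by
      gcongr; exact_mod_cast Nat.le_add_left 1 c)
    by_cases hs : sharp e = e
    · rw [hs] at h
      exact .inl (by rwa [hp])
    · refine .inr ⟨us.flatten, [], _, by simp, h, ?_⟩
      by_contra hlt
      exact hs (sharp_eq_of_idealCard_le he (hδ.trans (not_lt.1 hlt)))
  · refine .inl ?_
    rw [hp]
    refine (Tree.replicate he hne htree).mono ?_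
    gcongr
    omega

theorem Progress.power {e : M} (he : e * e = e) (hδ : idealCard e ≤ δ)
    {us : List (List M)} (hne : us ≠ []) (hus : ∀ u ∈ us, Progress c δ H u)
    (hprod : ∀ u ∈ us, u.prod = e) :
    Progress c δ (H + (c + 1 : ℕ) + 1) us.flatten := by
  -- Only the first block that does not evaluate to its product matters: it has a prefix with a
  -- small ideal, and the blocks before it form an ordinary power.
  have hsplit : (∀ u ∈ us, Tree c H u u.prod) ∨ ∃ vs b ws, us = vs ++ b :: ws ∧
      (∀ u ∈ vs, Tree c H u u.prod) ∧ ¬ Tree c H b b.prod := by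
    clear hne hus hprod
    induction us with
    | nil => simp
    | cons u us ih =>
      by_cases hu : Tree c H u u.prod
      · rcases ih with ih | ⟨vs, b, ws, rfl, h, hb⟩
        · exact .inl (by simpa [hu] using ih)
        · exact .inr ⟨u :: vs, b, ws, by simp, by simpa [hu] using h, hb⟩
      · exact .inr ⟨[], u, us, by simp, by simp, hu⟩
  rcases hsplit with h | ⟨vs, b, ws, rfl, h, hb⟩
  · exact (Progress.replicate he hδ hne h hprod).mono le_self_add
  · obtain ⟨u, v, a, rfl, hu, ha⟩ := (hus b (by simp)).resolve_left hb
    rcases vs.eq_nil_or_concat with rfl | hvs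
    · exact .inr ⟨u, v ++ ws.flatten, a, by simp, hu.mono (by rw [add_assoc]; exact le_self_add), ha⟩
    · have hvs : vs ≠ [] := by rcases hvs with ⟨_, _, rfl⟩; simp
      rcases Progress.replicate he hδ hvs h fun x hx => hprod x (by simp [hx]) with
        h | ⟨u', v', a', h', h, ha'⟩
      · exact .inr ⟨vs.flatten ++ u, v ++ ws.flatten, _, by simp,
          .mul h (hu.mono le_self_add) le_rfl, (idealCard_mul_le_right _ _).trans_lt ha⟩
      · exact .inr ⟨u', v' ++ (u ++ v) ++ ws.flatten, a', by simp [h'], h.mono le_self_add, ha'⟩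

theorem idealCard_prod_le {w : List M} (hne : w ≠ []) (hw : ∀ x ∈ w, idealCard x ≤ δ) :
    idealCard w.prod ≤ δ := by
  cases w with
  | nil => exact (hne rfl).elim
  | cons x w =>
    rw [List.prod_cons]
    exact (idealCard_mul_le_left _ _).trans (hw x (by simp))

/-- Stability puts `f` in the left ideal of `p * f = p`. With `f = q * p` one gets `f * f = q * p *
f = q * p = f`. -/
theorem idempotent_of_fixes {p s f : M} (hps : δ ≤ idealCard (p * s)) (hf : idealCard f ≤ δ)
    (hp : p * f = p) : f * f = f ∧ ∃ q, q * p = f := by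
  obtain ⟨q, hq⟩ := exists_mul_eq_of_idealCard_le (p := p) (x := f)
    (by rw [hp]; exact hf.trans (hps.trans (idealCard_mul_le_left _ _)))
  rw [hp] at hq
  refine ⟨?_, q, hq⟩
  calc f * f = q * (p * f) := by rw [← mul_assoc, hq]
    _ = f := by rw [hp, hq]

/-- Here `f = q * p` and dually `f' = s * r`, so `f = f * f' = f'`. Hence all factors between cuts
with the same label `(p, s)` have one common idempotent product. -/
theorem eq_of_fixes {p s f f' : M} (hps : δ ≤ idealCard (p * s)) (hf : idealCard f ≤ δ)
    (hf' : idealCard f' ≤ δ) (hp : p * f = p) (hs : f * s = s) (hp' : p * f' = p)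
    (hs' : f' * s = s) : f = f' := by
  obtain ⟨-, q, hq⟩ := idempotent_of_fixes hps hf hp
  obtain ⟨r, hr⟩ := exists_eq_mul_of_idealCard_le (p := s) (x := f')
    (by rw [hs']; exact hf'.trans (hps.trans (idealCard_mul_le_right _ _)))
  rw [hs'] at hr
  calc f = f * f' := by rw [← hq, mul_assoc, hp']
    _ = f' := by rw [← hr, ← mul_assoc, hs]

/-- Induction on the set of cut labels. Splitting `w` at every cut labelled `(p, s)` leaves factors
whose inner cuts have labels in the smaller set. The middle factors fix `p` and `s`, so they form a
power of one idempotent between two end factors. -/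
theorem progress_of_cutsIn (c δ : ℕ) (Λ : Set (M × M)) (hΛ : Λ.Finite) :
    ∃ H : ℕ, ∀ (P S : M) (w : List M), w ≠ [] → (∀ x ∈ w, idealCard x ≤ δ) →
      δ ≤ idealCard (P * w.prod * S) → CutsIn P S w Λ → Progress c δ H w := by
  induction Λ, hΛ using Set.Finite.induction_on with
  | empty =>
    refine ⟨0, fun P S w hne _ _ hcut => ?_⟩
    match w with
    | [] => exact (hne rfl).elim
    | [x] => exact .inl (by simpa using Tree.leaf _ x)
    | x :: y :: w => exact (hcut [x] (y :: w) rfl (by simp) (by simp)).elim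
  | @insert a Λ _ _ ih =>
    obtain ⟨H, ih⟩ := ih
    obtain ⟨p, s⟩ := a
    -- `c + 1` pays for the power, one more for a power followed by a small prefix of the next
    -- block, and two for joining the outer factors.
    refine ⟨H + (c + 1) + 1 + 1 + 1, fun P S w hne hw hδ hcut => ?_⟩
    by_cases hΛ : CutsIn P S w Λ
    · refine (ih P S w hne hw hδ hΛ).mono ?_
      exact_mod_cast (by omega)
    obtain ⟨u, v, rfl, hu, hv, hp, hs, hcu⟩ := hcut.first hΛ
    have hr := hcut.right
    rw [hp] at hr
    obtain ⟨B, z, rfl, hz, hcz, hB⟩ := CutsIn.split _ v le_rfl hv hs hr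
    have hps : δ ≤ idealCard (p * s) := by
      rw [← hp, ← hs]; simpa [mul_assoc] using hδ
    have hBw : ∀ b ∈ B, ∀ x ∈ b, idealCard x ≤ δ := fun b hb x hx =>
      hw x (by simp only [List.mem_append, List.mem_flatten]; exact .inr (.inl ⟨b, hb, hx⟩))
    have hPu : Progress c δ H u := ih P s u hu (fun x hx => hw x (by simp [hx]))
      (by rwa [hp]) hcu
    have hpB : p * B.flatten.prod = p := by
      clear hBw hcut hδ hne hw hΛ hv hs hr
      induction B with
      | nil => simp
      | cons b B ihB =>
        rw [List.flatten_cons, List.prod_append, ← mul_assoc, (hB b (by simp)).2.1]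
        exact ihB fun b hb => hB b (by simp [hb])
    have hPz : Progress c δ H z := ih p S z hz (fun x hx => hw x (by simp [hx])) (by
      rw [← hs, List.prod_append, mul_assoc, ← mul_assoc p, hpB, ← mul_assoc] at hps
      exact hps) hcz
    by_cases hBnil : B = []
    · subst hBnil
      refine (hPu.append hPz).mono ?_
      exact_mod_cast (by omega)
    obtain ⟨b₀, hb₀⟩ := List.exists_mem_of_ne_nil B hBnil
    have hcard : ∀ b ∈ B, idealCard b.prod ≤ δ := fun b hb =>
      idealCard_prod_le (hB b hb).1 (hBw b hb)
    have hPB : Progress c δ (H + (c + 1 : ℕ) + 1) B.flatten := by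
      refine Progress.power (e := b₀.prod)
        (idempotent_of_fixes hps (hcard b₀ hb₀) (hB b₀ hb₀).2.1).1 (hcard b₀ hb₀) hBnil
        (fun b hb => ih p s b (hB b hb).1 (hBw b hb) ?_ (hB b hb).2.2.2)
        (fun b hb => eq_of_fixes hps (hcard b hb) (hcard b₀ hb₀) (hB b hb).2.1 (hB b hb).2.2.1
          (hB b₀ hb₀).2.1 (hB b₀ hb₀).2.2.1)
      rwa [(hB b hb).2.1]
    have hfin := (hPu.mono (K := H + (c + 1 : ℕ) + 1 + 1) (by exact_mod_cast (by omega))).append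
      (hPB.append (hPz.mono (by exact_mod_cast (by omega))))
    exact hfin.mono (by exact_mod_cast (by omega))

/-- Every list of elements with small ideals makes progress. -/
theorem exists_progress (c δ : ℕ) : ∃ H : ℕ, ∀ w : List M, w ≠ [] →
    (∀ x ∈ w, idealCard x ≤ δ) → Progress c δ H w := by
  obtain ⟨H, hH⟩ := progress_of_cutsIn (M := M) c δ Set.univ Set.finite_univ
  refine ⟨H + 1, fun w hne hw => ?_⟩
  induction w using List.reverseRecOn with
  | nil => exact (hne rfl).elim
  | append_singleton u y ih =>
    by_cases hδ : δ ≤ idealCard (u ++ [y]).prod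
    · exact (hH 1 1 _ hne hw (by simpa using hδ) fun _ _ _ _ _ => trivial).mono
        (by exact_mod_cast Nat.le_succ H)
    by_cases hu : u = []
    · subst hu
      exact .inr ⟨[y], [], y, by simp, .leaf _ _, by simpa using hδ⟩
    have hw' : ∀ x ∈ u, idealCard x ≤ δ := fun x hx => hw x (by simp [hx])
    by_cases hδ' : δ ≤ idealCard u.prod
    · rcases hH 1 1 u hu hw' (by simpa using hδ') fun _ _ _ _ _ => trivial with
        h | ⟨u', v', a, rfl, h, ha⟩
      -- The last letter is the one that makes the ideal of the product fall below `δ`.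
      · refine .inr ⟨u ++ [y], [], u.prod * y, by simp, .mul h (.leaf _ _) (by norm_cast), ?_⟩
        simpa using hδ
      · exact .inr ⟨u', v' ++ [y], a, by simp, h.mono (by exact_mod_cast Nat.le_succ H), ha⟩
    · rcases ih hu hw' with h | ⟨u', v', a, rfl, h, ha⟩
      · exact .inr ⟨u, [y], u.prod, rfl, h, not_le.1 hδ'⟩
      · exact .inr ⟨u', v' ++ [y], a, by simp, h, ha⟩

/-- Prefixes with a smaller ideal are cut off greedily. Only the last factor may evaluate to its
product without any drop; `t` sets it apart. -/
theorem exists_reduction (c δ : ℕ) : ∃ H : ℕ, ∀ w : List M, (∀ x ∈ w, idealCard x ≤ δ + 1) →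
    ∃ (ls : List (List M)) (z t : List M), w = ls.flatten ∧ List.Forall₂ (Tree c H) ls (z ++ t) ∧
      t.length ≤ 1 ∧ ∀ x ∈ z, idealCard x ≤ δ := by
  obtain ⟨H, hH⟩ := exists_progress (M := M) c (δ + 1)
  refine ⟨H, fun w => ?_⟩
  induction hn : w.length using Nat.strong_induction_on generalizing w with
  | _ n ih =>
    intro hw
    by_cases hne : w = []
    · exact ⟨[], [], [], by simp [hne], by simp, by simp, by simp⟩
    rcases hH w hne hw with h | ⟨u, v, a, rfl, h, ha⟩
    · exact ⟨[w], [], [w.prod], by simp, .cons h .nil, by simp, by simp⟩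
    · have := List.length_pos_iff.2 h.ne_nil
      obtain ⟨ls, z, t, rfl, h₁, h₂, h₃⟩ := ih v.length (by simp at hn; omega) v rfl
        fun x hx => hw x (by simp [hx])
      refine ⟨u :: ls, a :: z, t, by simp, .cons h h₁, h₂, ?_⟩
      simpa using ⟨by omega, h₃⟩

/-- Each round lowers the bound on ideals by one, and the trees of the new round are grafted on the
old ones. The leftovers `t'` and `t` of the new and the earlier rounds are merged by one product
node, so a single leftover remains. -/
theorem exists_reduction_of_le (c n : ℕ) : ∃ H : ℕ, ∀ w : List M,
    ∃ (ls : List (List M)) (z t : List M), w = ls.flatten ∧ List.Forall₂ (Tree c H) ls (z ++ t) ∧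
      t.length ≤ 1 ∧ ∀ x ∈ z, idealCard x ≤ Nat.card M - n := by
  induction n with
  | zero =>
    refine ⟨0, fun w => ⟨w.map fun x => [x], w, [], ?_, ?_, by simp, fun x _ => ?_⟩⟩
    · induction w with
      | nil => rfl
      | cons x w ih => simpa using ih
    · induction w with
      | nil => exact .nil
      | cons x w ih => exact .cons (.leaf _ _) ih
    · exact Set.ncard_le_card _
  | succ n ih =>
    obtain ⟨H, hH⟩ := ih
    obtain ⟨K, hK⟩ := exists_reduction (M := M) c (Nat.card M - (n + 1))
    refine ⟨H + K + 1, fun w => ?_⟩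
    obtain ⟨ls, z, t, rfl, h₁, h₂, h₃⟩ := hH w
    obtain ⟨l₁, l₂, rfl, h₄, h₅⟩ := forall₂_append_right h₁
    obtain ⟨ks, z', t', rfl, h₆, h₇, h₈⟩ := hK z fun x hx => (h₃ x hx).trans (by omega)
    obtain ⟨ms, rfl, h₉⟩ := forall₂_flatten_right h₄
    obtain ⟨k₁, k₂, hk, h₁₀, h₁₁⟩ := forall₂_append_right (forall₂_tree_subst h₉ h₆)
    have hflat : (ms.flatten ++ l₂).flatten = k₁.flatten ++ (k₂.flatten ++ l₂.flatten) := by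
      rw [List.flatten_append, List.flatten_flatten, hk, List.flatten_append, List.append_assoc]
    have hle : ((H + K : ℕ) : ℕ∞) ≤ (H + K + 1 : ℕ) := by exact_mod_cast Nat.le_succ _
    have hle' : (H : ℕ∞) ≤ (H + K : ℕ) := by exact_mod_cast Nat.le_add_right _ _
    have hk₁ := h₁₀.imp fun _ _ h => Tree.mono h hle
    have hk₂ := h₁₁.imp fun _ _ h => Tree.mono h hle
    have hl₂ := h₅.imp fun _ _ h => Tree.mono h (hle'.trans hle)
    rw [hflat]
    match t', h₇, t, h₂ with
    | [], _, t, ht =>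
      cases h₁₁
      exact ⟨k₁ ++ l₂, z', t, by simp, List.rel_append hk₁ hl₂, ht, h₈⟩
    | [a], _, [], _ =>
      cases h₅
      exact ⟨k₁ ++ k₂, z', [a], by simp, List.rel_append hk₁ hk₂, by simp, h₈⟩
    | [a], _, [b], _ =>
      cases h₅ with
      | cons hb hnil =>
        cases hnil
        cases h₁₁ with
        | cons ha hnil =>
          cases hnil
          refine ⟨k₁ ++ [_ ++ _], z', [a * b], by simp, List.rel_append hk₁
            (.cons (.mul ha (hb.mono hle') (by norm_cast)) .nil), by simp, h₈⟩

/-- Every nonempty list has a factorisation tree of bounded height. -/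
theorem exists_tree (M : Type) [SharpMonoid M] [Finite M] (c : ℕ) :
    ∃ H : ℕ, ∀ w : List M, w ≠ [] → ∃ a, Tree c H w a := by
  obtain ⟨H, hH⟩ := exists_reduction_of_le (M := M) c (Nat.card M)
  refine ⟨H, fun w hw => ?_⟩
  obtain ⟨ls, z, t, rfl, h₁, h₂, h₃⟩ := hH w
  -- After `Nat.card M` rounds the bound is `0`, but ideals are nonempty.
  have hz : z = [] := by
    rw [List.eq_nil_iff_forall_not_mem]
    intro x hx
    have := h₃ x hx
    have := idealCard_pos x
    omega
  subst hz
  match t, h₂ with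
  | [], _ => cases h₁; simp at hw
  | [a], _ =>
    cases h₁ with
    | cons h h' => cases h'; exact ⟨a, by simpa using h⟩

end Progress

/-! ### Closures and power sets -/

section Closure

variable {M : Type} [SharpMonoid M]

/-- The closure of `E` under products and stabilisation of idempotents. The flag tells whether
stabilisation has been used. -/
inductive Clo (E : Set M) : Bool → M → Prop
  | base {x : M} : x ∈ E → Clo E false x
  | mul {b b' : Bool} {x y : M} : Clo E b x → Clo E b' y → Clo E (b || b') (x * y)
  | stab {b : Bool} {e : M} : Clo E b e → e * e = e → Clo E true (sharp e)

variable {E : Set M} {b : Bool} {a : M} {c : ℕ}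

/-- If `e = x * y` with `x ∈ E`, then `e♯ = e * e♯ = x * (y * e♯)`. This provides an absorption law
for the power algebra. -/
theorem Clo.exists_left (hE : E ⊆ Set.image2 (· * ·) E E) (h : Clo E b a) :
    ∃ x ∈ E, ∃ y, Clo E b y ∧ x * y = a := by
  induction h with
  | base hx =>
    obtain ⟨x, hx, y, hy, h⟩ := hE hx
    exact ⟨x, hx, y, .base hy, h⟩
  | mul _ h₂ i₁ _ =>
    obtain ⟨x, hx, y, hy, rfl⟩ := i₁
    exact ⟨x, hx, _, hy.mul h₂, by rw [mul_assoc]⟩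
  | @stab _ e h he i =>
    obtain ⟨x, hx, y, hy, hxy⟩ := i
    refine ⟨x, hx, y * sharp e, ?_, by rw [← mul_assoc, hxy, mul_sharp e he]⟩
    simpa using hy.mul (h.stab he)

theorem Clo.exists_right (hE : E ⊆ Set.image2 (· * ·) E E) (h : Clo E b a) :
    ∃ x, Clo E b x ∧ ∃ y ∈ E, x * y = a := by
  induction h with
  | base hx =>
    obtain ⟨x, hx, y, hy, h⟩ := hE hx
    exact ⟨x, .base hx, y, hy, h⟩
  | mul h₁ _ _ i₂ =>
    obtain ⟨x, hx, y, hy, rfl⟩ := i₂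
    exact ⟨_, h₁.mul hx, y, hy, by rw [mul_assoc]⟩
  | @stab _ e h he i =>
    obtain ⟨x, hx, y, hy, hxy⟩ := i
    refine ⟨sharp e * x, ?_, y, hy, by rw [mul_assoc, hxy, sharp_mul e he]⟩
    simpa using (h.stab he).mul hx

/-- A stabilised element splits as `e♯ = e♯ * e♯`, and outer factors do not erase the flag. Needed
for `S♯ * S♯ = S♯` when stabilisation is compulsory. -/
theorem Clo.exists_mul (h : Clo E b a) (hb : b = true) :
    ∃ x y, Clo E true x ∧ Clo E true y ∧ x * y = a := by
  induction h with
  | base => simp at hb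
  | @mul b b' x y h₁ h₂ i₁ i₂ =>
    rcases Bool.or_eq_true _ _ ▸ hb with rfl | rfl
    · obtain ⟨x₁, x₂, hx₁, hx₂, rfl⟩ := i₁ rfl
      exact ⟨x₁, x₂ * y, hx₁, by simpa using hx₂.mul h₂, by rw [mul_assoc]⟩
    · obtain ⟨x₁, x₂, hx₁, hx₂, rfl⟩ := i₂ rfl
      exact ⟨x * x₁, x₂, by simpa using h₁.mul hx₁, hx₂, by rw [mul_assoc]⟩
  | @stab _ e h he _ => exact ⟨_, _, h.stab he, h.stab he, sharp_mul_sharp e he⟩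

/-- Values of trees over `E` are in the closure of `E`; trees with many leaves use
stabilisation. -/
theorem Tree.clo {H : ℕ∞} {l : List M} (h : Tree c H l a) (hl : ∀ x ∈ l, x ∈ E) :
    ∀ n : ℕ, H ≤ n → ∃ b, Clo E b a ∧ (2 ^ n < l.length → b = true) := by
  induction h with
  | leaf =>
    intro n _
    exact ⟨false, .base (hl _ (by simp)), fun h => absurd h (by simp)⟩
  | @mul H H' u v _ _ _ _ h₃ i₁ i₂ =>
    intro n hn
    obtain ⟨m, rfl⟩ : ∃ m, n = m + 1 := by
      cases n with
      | zero => exact absurd (h₃.trans hn) (by simp)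
      | succ m => exact ⟨m, rfl⟩
    have hm : H ≤ m := by
      have := h₃.trans hn
      rw [Nat.cast_add, Nat.cast_one] at this
      exact (ENat.add_le_add_iff_right ENat.one_ne_top).1 this
    obtain ⟨b, hb, hb'⟩ := i₁ (fun x hx => hl x (by simp [hx])) m hm
    obtain ⟨d, hd, hd'⟩ := i₂ (fun x hx => hl x (by simp [hx])) m hm
    refine ⟨_, hb.mul hd, fun hlen => ?_⟩
    rw [List.length_append, pow_succ] at hlen
    rcases (by omega : 2 ^ m < u.length ∨ 2 ^ m < v.length) with h | h
    · simp [hb' h]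
    · simp [hd' h]
  | @stab H _ us e h₁ h₂ _ h₄ i =>
    intro n hn
    obtain ⟨u, hu⟩ := List.exists_mem_of_length_pos (l := us) (by omega)
    obtain ⟨b, hb, -⟩ := i u hu (fun x hx => hl x (List.mem_flatten.2 ⟨u, hu, hx⟩)) n
      ((le_self_add.trans h₄).trans hn)
    exact ⟨true, hb.stab h₁, fun _ => rfl⟩

/-- Elements of the closure are values of trees whose height does not depend on the arity of the
stabilisation nodes. -/
theorem Clo.exists_tree (h : Clo E b a) :
    ∃ H : ℕ, ∀ c : ℕ, ∃ l : List M, (∀ x ∈ l, x ∈ E) ∧ Tree c H l a := by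
  induction h with
  | @base x hx => exact ⟨0, fun c => ⟨[x], by simpa using hx, .leaf _ _⟩⟩
  | mul _ _ i₁ i₂ =>
    obtain ⟨H, hH⟩ := i₁
    obtain ⟨K, hK⟩ := i₂
    refine ⟨max H K + 1, fun c => ?_⟩
    obtain ⟨u, hu, hu'⟩ := hH c
    obtain ⟨v, hv, hv'⟩ := hK c
    refine ⟨u ++ v, fun x hx => (List.mem_append.1 hx).elim (hu x) (hv x), .mul
      (H := (max H K : ℕ)) (hu'.mono ?_) (hv'.mono ?_) (by norm_cast)⟩
    · exact_mod_cast le_max_left _ _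
    · exact_mod_cast le_max_right _ _
  | @stab _ e _ he i =>
    obtain ⟨H, hH⟩ := i
    refine ⟨H + 1, fun c => ?_⟩
    obtain ⟨u, hu, hu'⟩ := hH c
    refine ⟨(List.replicate (c + 1) u).flatten, ?_, .stab (H := H) he (by simp) ?_ (by norm_cast)⟩
    · intro x hx
      obtain ⟨v, hv, hxv⟩ := List.mem_flatten.1 hx
      exact hu x (List.eq_of_mem_replicate hv ▸ hxv)
    · intro v hv
      rwa [List.eq_of_mem_replicate hv]

theorem exists_tree_of_mem (hE : E ⊆ Set.image2 (· * ·) E E) (k : ℕ) :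
    ∀ a ∈ E, ∃ l : List M, l.length = k + 1 ∧ (∀ x ∈ l, x ∈ E) ∧ Tree c k l a := by
  induction k with
  | zero => exact fun a ha => ⟨[a], rfl, by simpa using ha, .leaf _ _⟩
  | succ k ih =>
    intro a ha
    obtain ⟨x, hx, y, hy, rfl⟩ := hE ha
    obtain ⟨l, hl, hl', ht⟩ := ih y hy
    exact ⟨[x] ++ l, by simp [hl], by simpa [hx] using hl', .mul (.leaf _ _) ht (by norm_cast)⟩

/-- If `E ⊆ E * E`, then the number of leaves may be chosen freely above a bound; the height is
bounded if stabilisation is used. -/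
theorem Clo.exists_tree_length (hE : E ⊆ Set.image2 (· * ·) E E) (c : ℕ) (h : Clo E b a) :
    ∃ K H : ℕ, 0 < K ∧ ∀ k, K ≤ k → ∃ l : List M, l.length = k ∧ (∀ x ∈ l, x ∈ E) ∧
      Tree c (H + if b then 0 else k : ℕ) l a := by
  induction h with
  | @base x hx =>
    refine ⟨1, 0, one_pos, fun k hk => ?_⟩
    obtain ⟨k, rfl⟩ := Nat.exists_eq_add_of_le' hk
    obtain ⟨l, hl, hl', ht⟩ := exists_tree_of_mem (c := c) hE k x hx
    exact ⟨l, hl, hl', ht.mono (by simp)⟩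
  | @mul b b' x y h₁ h₂ i₁ i₂ =>
    obtain ⟨K₁, H₁, hK₁, i₁⟩ := i₁
    obtain ⟨K₂, H₂, hK₂, i₂⟩ := i₂
    refine ⟨K₁ + K₂, H₁ + H₂ + K₁ + K₂ + 1, by omega, fun k hk => ?_⟩
    -- The surplus leaves go to a factor that uses stabilisation, where they cost no height. If
    -- there is none, the height may grow with `k` anyway.
    obtain ⟨k₁, k₂, hk₁, hk₂, hk12, hb, hb'⟩ : ∃ k₁ k₂, K₁ ≤ k₁ ∧ K₂ ≤ k₂ ∧ k₁ + k₂ = k ∧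
        (if b then 0 else k₁) ≤ K₁ + (if b || b' then 0 else k) ∧
        (if b' then 0 else k₂) ≤ K₂ + (if b || b' then 0 else k) := by
      cases b
      · refine ⟨K₁, k - K₁, le_rfl, by omega, by omega, by simp, ?_⟩
        cases b' <;> simp
        omega
      · exact ⟨k - K₂, K₂, by omega, le_rfl, by omega, by simp, by cases b' <;> simp⟩
    obtain ⟨u, hu, hu', htu⟩ := i₁ k₁ hk₁
    obtain ⟨v, hv, hv', htv⟩ := i₂ k₂ hk₂
    refine ⟨u ++ v, by simp [hu, hv, hk12],
      fun x hx => (List.mem_append.1 hx).elim (hu' x) (hv' x), .mul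
      (H := (H₁ + H₂ + K₁ + K₂ + if b || b' then 0 else k : ℕ))
      (htu.mono ?_) (htv.mono ?_) ?_⟩
    · exact Nat.cast_le.2 (by omega)
    · exact Nat.cast_le.2 (by omega)
    · exact_mod_cast (by omega)
  | @stab b e _ he i =>
    obtain ⟨K, H, hK, i⟩ := i
    -- There are `k / K > c` children with `K` leaves each, except that the first takes the
    -- remainder too. All have fewer than `2 * K` leaves, so their heights are bounded even if `e`
    -- was reached without stabilisation.
    refine ⟨(c + 1) * K, H + 2 * K + 1, by positivity, fun k hk => ?_⟩
    have hq : c + 1 ≤ k / K := (Nat.le_div_iff_mul_le hK).2 hk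
    have hmod := Nat.mod_lt k hK
    have hdiv := Nat.div_add_mod k K
    obtain ⟨u, hu, hu', htu⟩ := i (K + k % K) (by omega)
    obtain ⟨v, hv, hv', htv⟩ := i K le_rfl
    refine ⟨(u :: List.replicate (k / K - 1) v).flatten, ?_, ?_, .stab (H := (H + 2 * K : ℕ)) he
      (by simp; omega) ?_ (by simp)⟩
    · obtain ⟨m, hm⟩ : ∃ m, k / K = m + 1 := ⟨k / K - 1, by omega⟩
      rw [hm] at hdiv
      simp [hu, hv, hm]
      nlinarith
    · intro x hx
      obtain ⟨w, hw, hxw⟩ := List.mem_flatten.1 hx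
      rcases List.mem_cons.1 hw with rfl | hw
      · exact hu' x hxw
      · exact hv' x (List.eq_of_mem_replicate hw ▸ hxw)
    · intro w hw
      rcases List.mem_cons.1 hw with rfl | hw
      · exact htu.mono (Nat.cast_le.2 (by cases b <;> simp <;> omega))
      · rw [List.eq_of_mem_replicate hw]
        exact htv.mono (Nat.cast_le.2 (by cases b <;> simp <;> omega))

end Closure

/-! ### Power algebras, lifting and projection of trees -/

/-- Sets of elements of `M`, as values of projections: infima for `q = true`, suprema for
`q = false`. -/
@[ext] structure Pow (q : Bool) (M : Type) where
  carrier : Set M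

section Pow

variable {M : Type} [SharpMonoid M] {q : Bool}

instance [Finite M] : Finite (Pow q M) :=
  Finite.of_injective Pow.carrier fun _ _ h => Pow.ext h

instance : Monoid (Pow q M) where
  mul S T := ⟨Set.image2 (· * ·) S.carrier T.carrier⟩
  one := ⟨{1}⟩
  mul_assoc S T U := Pow.ext (Set.image2_assoc mul_assoc)
  one_mul S := Pow.ext (by
    change Set.image2 _ {1} _ = _
    simp)
  mul_one S := Pow.ext (by
    change Set.image2 _ _ {1} = _
    simp)

theorem Pow.carrier_one : (1 : Pow q M).carrier = {1} := rfl

theorem Pow.carrier_mul (S T : Pow q M) :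
    (S * T).carrier = Set.image2 (· * ·) S.carrier T.carrier := rfl

theorem Pow.carrier_subset {S : Pow q M} (h : S * S = S) :
    S.carrier ⊆ Set.image2 (· * ·) S.carrier S.carrier := by
  rw [← Pow.carrier_mul, h]

/-- The values that long products of elements of `S` can take. -/
def Pow.stab (S : Pow q M) : Pow q M := ⟨{x | ∃ b, (q = true → b = true) ∧ Clo S.carrier b x}⟩

instance : SharpMonoid (Pow q M) where
  sharp := Pow.stab
  mul_sharp S hS := by
    ext x
    constructor
    · rintro ⟨a, ha, y, ⟨b, hb, hy⟩, rfl⟩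
      exact ⟨b, hb, by simpa using (Clo.base ha).mul hy⟩
    · rintro ⟨b, hb, hx⟩
      obtain ⟨a, ha, y, hy, rfl⟩ := hx.exists_left (Pow.carrier_subset hS)
      exact ⟨a, ha, y, ⟨b, hb, hy⟩, rfl⟩
  sharp_mul S hS := by
    ext x
    constructor
    · rintro ⟨y, ⟨b, hb, hy⟩, a, ha, rfl⟩
      exact ⟨b, hb, by simpa using hy.mul (Clo.base ha)⟩
    · rintro ⟨b, hb, hx⟩
      obtain ⟨y, hy, a, ha, rfl⟩ := hx.exists_right (Pow.carrier_subset hS)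
      exact ⟨y, ⟨b, hb, hy⟩, a, ha, rfl⟩
  sharp_mul_sharp S hS := by
    ext x
    constructor
    · rintro ⟨y, ⟨b, hb, hy⟩, z, ⟨d, hd, hz⟩, rfl⟩
      exact ⟨b || d, fun hq => by simp [hb hq], hy.mul hz⟩
    · rintro ⟨b, hb, hx⟩
      cases q with
      | false =>
        obtain ⟨y, hy, a, ha, rfl⟩ := hx.exists_right (Pow.carrier_subset hS)
        exact ⟨y, ⟨b, hb, hy⟩, a, ⟨false, by simp, .base ha⟩, rfl⟩
      | true =>
        obtain ⟨y, z, hy, hz, rfl⟩ := hx.exists_mul (hb rfl)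
        exact ⟨y, ⟨true, by simp, hy⟩, z, ⟨true, by simp, hz⟩, rfl⟩

theorem Pow.mem_sharp {S : Pow q M} {x : M} :
    x ∈ (sharp S).carrier ↔ ∃ b, (q = true → b = true) ∧ Clo S.carrier b x := Iff.rfl

theorem forall₂_choose₂ {α β γ : Type*} {R : α → β → Prop} {T : α → γ → Prop} {us : List β}
    {xs : List γ} (h : List.Forall₂ (fun u x => ∃ l, R l u ∧ T l x) us xs) :
    ∃ ls, List.Forall₂ R ls us ∧ List.Forall₂ T ls xs := by
  induction h with
  | nil => exact ⟨[], .nil, .nil⟩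
  | cons h _ ih =>
    obtain ⟨l, h₁, h₂⟩ := h
    obtain ⟨ls, h₃, h₄⟩ := ih
    exact ⟨l :: ls, .cons h₁ h₃, .cons h₂ h₄⟩

theorem forall₂_of_length_eq {α β : Type*} {R : α → β → Prop} :
    ∀ {l : List α} {l' : List β}, l.length = l'.length → (∀ x ∈ l, ∀ y ∈ l', R x y) →
      List.Forall₂ R l l'
  | [], [], _, _ => .nil
  | _ :: _, _ :: _, h, hR => .cons (hR _ (by simp) _ (by simp))
      (forall₂_of_length_eq (by simpa using h) fun x hx y hy => hR x (by simp [hx]) y (by simp [hy]))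

/-- Every element of the value of a tree over sets is the value of a choice of elements. -/
theorem Pow.exists_lift (q : Bool) (M : Type) [SharpMonoid M] [Finite M] (c : ℕ) :
    ∃ c' K : ℕ, ∀ (H : ℕ∞) (ls : List (Pow q M)) (S : Pow q M), Tree c' H ls S →
      ∀ a ∈ S.carrier, ∃ l, List.Forall₂ (fun x S => x ∈ S.carrier) l ls ∧
        Tree c (if q then H * K else ⊤) l a := by
  -- The conclusion is asked for all large `K`, so that the maximum over the finitely many pairs
  -- serves them all.
  have hK : ∀ p : Pow q M × M, ∃ K₀ : ℕ, ∀ K, K₀ ≤ K → p.1 * p.1 = p.1 →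
      p.2 ∈ (sharp p.1).carrier → ∀ k, K ≤ k → ∃ l : List M, l.length = k ∧
        (∀ x ∈ l, x ∈ p.1.carrier) ∧ Tree c (if q then (K : ℕ∞) else ⊤) l p.2 := by
    rintro ⟨S, a⟩
    by_cases h : S * S = S ∧ a ∈ (sharp S).carrier
    · obtain ⟨hS, b, hb, ha⟩ := h
      obtain ⟨K, H, -, hKH⟩ := ha.exists_tree_length (Pow.carrier_subset hS) c
      refine ⟨K + H, fun K' hK' _ _ k hk => ?_⟩
      obtain ⟨l, hl, hl', ht⟩ := hKH k (by omega)
      refine ⟨l, hl, hl', ht.mono ?_⟩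
      cases q with
      | false => simp
      | true => simpa [hb rfl] using (by omega : H ≤ K')
    · exact ⟨0, fun _ _ h₁ h₂ => (h ⟨h₁, h₂⟩).elim⟩
  choose f hf using hK
  obtain ⟨K, hK⟩ := Finite.exists_le f
  -- One level becomes up to `K` levels; `K + 1` is positive and so also pays for a binary node.
  refine ⟨K + 1, K + 1, fun H ls S h => ?_⟩
  have hB : ∀ {H H' : ℕ∞}, H + 1 ≤ H' →
      (if q then H * (K + 1 : ℕ) else ⊤) + (if q then ((K + 1 : ℕ) : ℕ∞) else ⊤) ≤
        (if q then H' * (K + 1 : ℕ) else ⊤) := by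
    intro H H' hH
    cases q with
    | false => simp
    | true =>
      simp only [if_true]
      calc H * ((K + 1 : ℕ) : ℕ∞) + (K + 1 : ℕ) = (H + 1) * (K + 1 : ℕ) := by ring
        _ ≤ _ := by gcongr
  have hone : (1 : ℕ∞) ≤ if q then ((K + 1 : ℕ) : ℕ∞) else ⊤ := by
    cases q with
    | false => simp
    | true => simp
  induction h with
  | leaf H S => exact fun a ha => ⟨[a], .cons ha .nil, .leaf _ _⟩
  | mul _ _ h₃ i₁ i₂ =>
    rintro _ ⟨x, hx, y, hy, rfl⟩
    obtain ⟨u, hu, htu⟩ := i₁ x hx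
    obtain ⟨v, hv, htv⟩ := i₂ y hy
    exact ⟨u ++ v, List.rel_append hu hv, .mul htu htv ((add_le_add_right hone _).trans (hB h₃))⟩
  | @stab H H' us S h₁ h₂ _ h₄ i =>
    intro a ha
    -- The number of children is imposed, hence the need for a tree over `S` with exactly that many
    -- leaves. The lifted children are then grafted on it.
    obtain ⟨xs, hlen, hxs, ht⟩ := hf (S, a) (K + 1) ((hK _).trans (Nat.le_succ K)) h₁ ha
      us.length h₂.le
    obtain ⟨ls, hls, hls'⟩ := forall₂_choose₂ (forall₂_of_length_eq hlen.symm
      fun u hu x hx => i u hu x (hxs x hx))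
    exact ⟨ls.flatten, forall₂_flatten hls, (ht.subst hls').mono (hB h₄)⟩

/-- Every choice of elements evaluates into the value of a tree over sets. -/
theorem Pow.exists_proj (q : Bool) (M : Type) [SharpMonoid M] [Finite M] (c : ℕ) :
    ∃ c' K : ℕ, ∀ (H : ℕ∞) (ls : List (Pow q M)) (S : Pow q M), Tree c' H ls S →
      ∀ l, List.Forall₂ (fun x S => x ∈ S.carrier) l ls →
        ∃ a ∈ S.carrier, Tree c (H * K) l a := by
  obtain ⟨K, hK⟩ := exists_tree M c
  -- A tree of height at most `K` with more than `2 ^ K` leaves must use stabilisation. This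
  -- threshold therefore puts the value in `S♯` even when the flag is required.
  refine ⟨2 ^ K, K + 1, fun H ls S h => ?_⟩
  have hB : ∀ {H H' : ℕ∞}, H + 1 ≤ H' →
      H * (K + 1 : ℕ) + (K + 1 : ℕ) ≤ H' * (K + 1 : ℕ) := by
    intro H H' hH
    calc H * ((K + 1 : ℕ) : ℕ∞) + (K + 1 : ℕ) = (H + 1) * (K + 1 : ℕ) := by ring
      _ ≤ _ := by gcongr
  induction h with
  | leaf H S =>
    intro l hl
    cases hl with
    | cons h h' => cases h'; exact ⟨_, h, .leaf _ _⟩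
  | mul _ _ h₃ i₁ i₂ =>
    intro l hl
    obtain ⟨u, v, rfl, hu, hv⟩ := forall₂_append_right hl
    obtain ⟨x, hx, htu⟩ := i₁ u hu
    obtain ⟨y, hy, htv⟩ := i₂ v hv
    refine ⟨x * y, ⟨x, hx, y, hy, rfl⟩, .mul htu htv (le_trans ?_ (hB h₃))⟩
    gcongr
    simp
  | @stab H H' us S h₁ h₂ _ h₄ i =>
    intro l hl
    obtain ⟨ls, rfl, hls⟩ := forall₂_flatten_right hl
    obtain ⟨xs, hxs⟩ := forall₂_choose (l' := ls)
      (R := fun x l => x ∈ S.carrier ∧ Tree c (H * (K + 1 : ℕ)) l x) fun l hl => by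
        obtain ⟨u, hu, h⟩ := forall₂_exists_left hls hl
        exact i u hu l h
    have hlen : xs.length = us.length := hxs.length_eq.trans hls.length_eq
    obtain ⟨a, ha⟩ := hK xs (List.ne_nil_of_length_pos (by rw [hlen]; exact (Nat.zero_le _).trans_lt h₂))
    obtain ⟨b, hb, hb'⟩ := ha.clo (E := S.carrier)
      (fun x hx => by obtain ⟨_, _, h⟩ := forall₂_exists_left hxs hx; exact h.1) K le_rfl
    refine ⟨a, ⟨b, fun _ => hb' (by omega), hb⟩, ?_⟩
    refine (ha.subst (hxs.flip.imp fun _ _ h => h.2)).mono (le_trans ?_ (hB h₄))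
    gcongr
    exact_mod_cast Nat.le_succ K

end Pow

/-! ### Recognition of formulae -/

instance {M N : Type} [SharpMonoid M] [SharpMonoid N] : SharpMonoid (M × N) where
  sharp p := (sharp p.1, sharp p.2)
  mul_sharp _ he := Prod.ext (mul_sharp _ (congrArg Prod.fst he)) (mul_sharp _ (congrArg Prod.snd he))
  sharp_mul _ he := Prod.ext (sharp_mul _ (congrArg Prod.fst he)) (sharp_mul _ (congrArg Prod.snd he))
  sharp_mul_sharp _ he := Prod.ext (sharp_mul_sharp _ (congrArg Prod.fst he))
    (sharp_mul_sharp _ (congrArg Prod.snd he))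

section Eval

variable {M N : Type} [SharpMonoid M] [SharpMonoid N] {c : ℕ} {H K : ℕ∞}

/-- Evaluation of possibly empty lists. -/
def Eval (c : ℕ) (H : ℕ∞) (l : List M) (a : M) : Prop := (l = [] ∧ a = 1) ∨ Tree c H l a

theorem Eval.mono {l : List M} {a : M} (h : Eval c H l a) (hK : H ≤ K) : Eval c K l a :=
  h.imp_right fun h => h.mono hK

theorem Eval.anti {c' : ℕ} {l : List M} {a : M} (h : Eval c H l a) (hc : c' ≤ c) :
    Eval c' H l a :=
  h.imp_right fun h => h.anti hc

theorem Eval.fst {l : List (M × N)} {p : M × N} (h : Eval c H l p) :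
    Eval c H (l.map Prod.fst) p.1 := by
  rcases h with ⟨rfl, rfl⟩ | h
  · exact .inl ⟨rfl, rfl⟩
  · exact .inr (h.map Prod.fst (fun _ _ => rfl) fun _ => rfl)

theorem Eval.snd {l : List (M × N)} {p : M × N} (h : Eval c H l p) :
    Eval c H (l.map Prod.snd) p.2 := by
  rcases h with ⟨rfl, rfl⟩ | h
  · exact .inl ⟨rfl, rfl⟩
  · exact .inr (h.map Prod.snd (fun _ _ => rfl) fun _ => rfl)

/-- With trivial stabilisation the tree is irrelevant, which suits the formulae whose truth does not
depend on `N`. -/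
theorem Eval.eq_prod (hsh : ∀ x : M, sharp x = x) {l : List M} {a : M} (h : Eval c H l a) :
    l.prod = a := by
  rcases h with ⟨rfl, rfl⟩ | h
  · rfl
  · induction h with
    | leaf => simp
    | mul _ _ _ i₁ i₂ => rw [List.prod_append, i₁, i₂]
    | stab h₁ h₂ _ _ i =>
      rw [hsh]
      exact prod_flatten_of_idempotent h₁ (List.ne_nil_of_length_pos (by omega)) i

end Eval

section Letters

variable {A : Type*} {M : Type}

/-- The list of the values of the positions of `u`, labelled with the sets of the variables
that contain them. -/
def letters (h : A → Set ℕ → M) (u : List A) (ν : Valuation u) : List M :=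
  List.ofFn fun i : Fin u.length => h (u.get i) {X | i ∈ ν X}

theorem letters_empty (h : A → Set ℕ → M) (u : List A) :
    (letters h u fun _ => ∅) = u.map fun a => h a ∅ := by
  simp only [letters, Set.mem_empty_iff_false]
  refine List.ext_getElem (by simp) fun i hi hi' => ?_
  simp

/-- The letters after projection of the variable `X`. -/
def projLetter (q : Bool) (X : ℕ) (h : A → Set ℕ → M) (a : A) (S : Set ℕ) : Pow q M :=
  ⟨{h a (insert X S), h a (S \ {X})}⟩

theorem letterSet_update {u : List A} (ν : Valuation u) (X : ℕ) (E : Set (Fin u.length))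
    (i : Fin u.length) : {Y | i ∈ Function.update ν X E Y} =
      {Y | (Y = X ∧ i ∈ E) ∨ (Y ≠ X ∧ i ∈ ν Y)} := by
  ext Y
  by_cases hY : Y = X
  · subst hY; simp
  · simp [hY]

theorem letterSet_update_of_mem {u : List A} (ν : Valuation u) (X : ℕ) {E : Set (Fin u.length)}
    {i : Fin u.length} (hi : i ∈ E) : {Y | i ∈ Function.update ν X E Y} =
      insert X {Y | i ∈ ν Y} := by
  rw [letterSet_update]
  ext Y
  by_cases hY : Y = X <;> simp [hY, hi]

theorem letterSet_update_of_notMem {u : List A} (ν : Valuation u) (X : ℕ)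
    {E : Set (Fin u.length)} {i : Fin u.length} (hi : i ∉ E) :
    {Y | i ∈ Function.update ν X E Y} = {Y | i ∈ ν Y} \ {X} := by
  rw [letterSet_update]
  ext Y
  by_cases hY : Y = X <;> simp [hY, hi]

theorem forall₂_ofFn {α β : Type*} {R : α → β → Prop} :
    ∀ {n : ℕ} {f : Fin n → α} {g : Fin n → β}, (∀ i, R (f i) (g i)) →
      List.Forall₂ R (List.ofFn f) (List.ofFn g)
  | 0, _, _, _ => by simp
  | n + 1, f, g, h => by
    rw [List.ofFn_succ, List.ofFn_succ]
    exact .cons (h 0) (forall₂_ofFn fun i => h i.succ)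

theorem exists_ofFn_of_forall₂ {α β : Type*} {R : α → β → Prop} :
    ∀ {n : ℕ} {l : List α} {g : Fin n → β}, List.Forall₂ R l (List.ofFn g) →
      ∃ f : Fin n → α, l = List.ofFn f ∧ ∀ i, R (f i) (g i)
  | 0, l, g, h => ⟨Fin.elim0, by simpa using h, fun i => i.elim0⟩
  | n + 1, l, g, h => by
    rw [List.ofFn_succ] at h
    cases h with
    | @cons x _ _ _ h h' =>
      obtain ⟨f, rfl, hf⟩ := exists_ofFn_of_forall₂ h'
      exact ⟨Fin.cons x f, by simp [List.ofFn_succ], Fin.cases h hf⟩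

theorem forall₂_letters_update (q : Bool) (X : ℕ) (h : A → Set ℕ → M) (u : List A)
    (ν : Valuation u) (E : Set (Fin u.length)) :
    List.Forall₂ (fun x (S : Pow q M) => x ∈ S.carrier) (letters h u (Function.update ν X E))
      (letters (projLetter q X h) u ν) := by
  refine forall₂_ofFn fun i => ?_
  by_cases hE : i ∈ E
  · rw [letterSet_update_of_mem ν X hE]
    exact .inl rfl
  · rw [letterSet_update_of_notMem ν X hE]
    exact .inr rfl

theorem exists_update_of_forall₂ {q : Bool} {X : ℕ} {h : A → Set ℕ → M} {u : List A}
    {ν : Valuation u} {l : List M} (hl : List.Forall₂ (fun x (S : Pow q M) => x ∈ S.carrier) l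
      (letters (projLetter q X h) u ν)) :
    ∃ E : Set (Fin u.length), l = letters h u (Function.update ν X E) := by
  obtain ⟨f, rfl, hf⟩ := exists_ofFn_of_forall₂ hl
  -- Where both markings of a letter have the same value, either is correct; this choice marks the
  -- position.
  refine ⟨{i | f i = h (u.get i) (insert X {Y | i ∈ ν Y})}, ?_⟩
  refine congrArg List.ofFn (funext fun i => ?_)
  by_cases hE : f i = h (u.get i) (insert X {Y | i ∈ ν Y})
  · rw [letterSet_update_of_mem ν X (by exact hE), hE]
  · rw [letterSet_update_of_notMem ν X (by exact hE)]
    exact (hf i).resolve_left hE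

end Letters

section Recognition

variable {A : Type*} {M N : Type} [SharpMonoid M] [SharpMonoid N]

/-- Cardinality bounds occur only positively. -/
theorem Sat.mono {u : List A} {m n : ℕ} (hmn : m ≤ n) {φ : Formula A} {ν : Valuation u}
    (h : Sat u m φ ν) : Sat u n φ ν := by
  induction φ generalizing ν with
  | pos R => exact h
  | neg R => exact h
  | cardLe X => exact le_trans (show (ν X).encard ≤ m from h) (by exact_mod_cast hmn)
  | and φ ψ i j => exact ⟨i h.1, j h.2⟩
  | or φ ψ i j => exact h.imp i j
  | ex X φ i => exact h.imp fun _ => i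
  | all X φ i => exact fun E => i (h E)

theorem Formula.value_le_iff {φ : Formula A} {u : List A} {ν : Valuation u} {n : ℕ} :
    φ.value u ν ≤ n ↔ Sat u n φ ν := by
  constructor
  · intro h
    by_contra hn
    have : ((n + 1 : ℕ) : ℕ∞) ≤ φ.value u ν := by
      refine le_iInf₂ fun m hm => ?_
      by_contra hlt
      exact hn (hm.mono (by have := Nat.cast_lt.1 (not_le.1 hlt); omega))
    have := Nat.cast_le.1 (this.trans h)
    omega
  · exact fun h => iInf₂_le n h

/-- `φ` is recognised by `h` with accepting set `G`, up to a change of bounds. -/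
structure Recognises (φ : Formula A) (h : A → Set ℕ → M) (G : Set M) : Prop where
  upper : ∃ c, ∀ H : ℕ, ∃ n, ∀ u ν a, Eval c H (letters h u ν) a → a ∈ G → Sat u n φ ν
  lower : ∀ n, ∃ c, ∀ u ν a, Eval c ⊤ (letters h u ν) a → Sat u n φ ν → a ∈ G

variable {φ ψ : Formula A} {h : A → Set ℕ → M} {k : A → Set ℕ → N} {G : Set M} {G' : Set N}

theorem Recognises.of_prod (hsh : ∀ x : M, sharp x = x)
    (hφ : ∀ u n ν, Sat u n φ ν ↔ (letters h u ν).prod ∈ G) : Recognises φ h G where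
  upper := ⟨0, fun H => ⟨0, fun u ν a ha hG => (hφ u 0 ν).2 (by rwa [ha.eq_prod hsh])⟩⟩
  lower n := ⟨0, fun u ν a ha hs => by rw [← ha.eq_prod hsh]; exact (hφ u n ν).1 hs⟩

theorem Eval.letters_fst {c : ℕ} {H : ℕ∞} {u : List A} {ν : Valuation u} {p : M × N}
    (hp : Eval c H (letters (fun a S => (h a S, k a S)) u ν) p) :
    Eval c H (letters h u ν) p.1 := by
  simpa [letters, List.map_ofFn, Function.comp_def] using hp.fst

theorem Eval.letters_snd {c : ℕ} {H : ℕ∞} {u : List A} {ν : Valuation u} {p : M × N}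
    (hp : Eval c H (letters (fun a S => (h a S, k a S)) u ν) p) :
    Eval c H (letters k u ν) p.2 := by
  simpa [letters, List.map_ofFn, Function.comp_def] using hp.snd

theorem Recognises.and (hφ : Recognises φ h G) (hψ : Recognises ψ k G') :
    Recognises (φ.and ψ) (fun a S => (h a S, k a S)) {p | p.1 ∈ G ∧ p.2 ∈ G'} where
  upper := by
    obtain ⟨c, hc⟩ := hφ.upper
    obtain ⟨d, hd⟩ := hψ.upper
    refine ⟨max c d, fun H => ?_⟩
    obtain ⟨m, hm⟩ := hc H
    obtain ⟨n, hn⟩ := hd H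
    refine ⟨max m n, fun u ν p hp hG => ⟨?_, ?_⟩⟩
    · exact (hm u ν _ (hp.letters_fst.anti (le_max_left c d)) hG.1).mono (le_max_left _ _)
    · exact (hn u ν _ (hp.letters_snd.anti (le_max_right c d)) hG.2).mono
        (le_max_right _ _)
  lower n := by
    obtain ⟨c, hc⟩ := hφ.lower n
    obtain ⟨d, hd⟩ := hψ.lower n
    refine ⟨max c d, fun u ν p hp hs => ⟨?_, ?_⟩⟩
    · exact hc u ν _ (hp.letters_fst.anti (le_max_left c d)) hs.1
    · exact hd u ν _ (hp.letters_snd.anti (le_max_right c d)) hs.2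

theorem Recognises.or (hφ : Recognises φ h G) (hψ : Recognises ψ k G') :
    Recognises (φ.or ψ) (fun a S => (h a S, k a S)) {p | p.1 ∈ G ∨ p.2 ∈ G'} where
  upper := by
    obtain ⟨c, hc⟩ := hφ.upper
    obtain ⟨d, hd⟩ := hψ.upper
    refine ⟨max c d, fun H => ?_⟩
    obtain ⟨m, hm⟩ := hc H
    obtain ⟨n, hn⟩ := hd H
    refine ⟨max m n, fun u ν p hp hG => hG.imp (fun hG => ?_) fun hG => ?_⟩
    · exact (hm u ν _ (hp.letters_fst.anti (le_max_left c d)) hG).mono (le_max_left _ _)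
    · exact (hn u ν _ (hp.letters_snd.anti (le_max_right c d)) hG).mono
        (le_max_right _ _)
  lower n := by
    obtain ⟨c, hc⟩ := hφ.lower n
    obtain ⟨d, hd⟩ := hψ.lower n
    refine ⟨max c d, fun u ν p hp hs => hs.imp (fun hs => ?_) fun hs => ?_⟩
    · exact hc u ν _ (hp.letters_fst.anti (le_max_left c d)) hs
    · exact hd u ν _ (hp.letters_snd.anti (le_max_right c d)) hs

variable [Finite M]

theorem Eval.exists_lift (q : Bool) (X : ℕ) (h : A → Set ℕ → M) (c : ℕ) :
    ∃ c' K : ℕ, ∀ (H : ℕ∞) u ν S, Eval c' H (letters (projLetter q X h) u ν) S →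
      ∀ a ∈ S.carrier, ∃ E, Eval c (if q then H * K else ⊤)
        (letters h u (Function.update ν X E)) a := by
  obtain ⟨c', K, hK⟩ := Pow.exists_lift q M c
  refine ⟨c', K, fun H u ν S hS a ha => ?_⟩
  rcases hS with ⟨hnil, rfl⟩ | hS
  · obtain ⟨E, hE⟩ := exists_update_of_forall₂ (q := q) (X := X) (h := h) (ν := ν) (l := [])
      (by rw [hnil]; exact .nil)
    exact ⟨E, .inl ⟨hE.symm, ha⟩⟩
  · obtain ⟨l, hl, ht⟩ := hK H _ S hS a ha
    obtain ⟨E, rfl⟩ := exists_update_of_forall₂ hl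
    exact ⟨E, .inr ht⟩

theorem Eval.exists_proj (q : Bool) (X : ℕ) (h : A → Set ℕ → M) (c : ℕ) :
    ∃ c' K : ℕ, ∀ (H : ℕ∞) u ν S, Eval c' H (letters (projLetter q X h) u ν) S →
      ∀ E, ∃ a ∈ S.carrier, Eval c (H * K) (letters h u (Function.update ν X E)) a := by
  obtain ⟨c', K, hK⟩ := Pow.exists_proj q M c
  refine ⟨c', K, fun H u ν S hS E => ?_⟩
  have hl := forall₂_letters_update q X h u ν E
  rcases hS with ⟨hnil, rfl⟩ | hS
  · rw [hnil] at hl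
    exact ⟨1, rfl, .inl ⟨List.forall₂_nil_right_iff.1 hl, rfl⟩⟩
  · obtain ⟨a, ha, ht⟩ := hK H _ S hS _ hl
    exact ⟨a, ha, .inr ht⟩

/-- Upper bounds come from lifting an accepted element to a witness, at the price of a constant
factor in height. Lower bounds come from projecting a given witness, where height is free. -/
theorem Recognises.ex (X : ℕ) (hφ : Recognises φ h G) :
    Recognises (φ.ex X) (projLetter true X h) {S | ∃ a ∈ S.carrier, a ∈ G} where
  upper := by
    obtain ⟨c, hc⟩ := hφ.upper
    obtain ⟨c', K, hK⟩ := Eval.exists_lift true X h c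
    refine ⟨c', fun H => ?_⟩
    obtain ⟨n, hn⟩ := hc (H * K)
    refine ⟨n, fun u ν S hS ⟨a, ha, hG⟩ => ?_⟩
    obtain ⟨E, hE⟩ := hK H u ν S hS a ha
    exact ⟨E, hn u _ a (by simpa using hE) hG⟩
  lower n := by
    obtain ⟨c, hc⟩ := hφ.lower n
    obtain ⟨c', K, hK⟩ := Eval.exists_proj true X h c
    refine ⟨c', fun u ν S hS ⟨E, hE⟩ => ?_⟩
    obtain ⟨a, ha, ht⟩ := hK ⊤ u ν S hS E
    exact ⟨a, ha, hc u _ a (ht.mono le_top) hE⟩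

/-- The roles are exchanged: every set must project with controlled height for the upper bound, and
lifts of unbounded height suffice for the lower one. -/
theorem Recognises.all (X : ℕ) (hφ : Recognises φ h G) :
    Recognises (φ.all X) (projLetter false X h) {S | ∀ a ∈ S.carrier, a ∈ G} where
  upper := by
    obtain ⟨c, hc⟩ := hφ.upper
    obtain ⟨c', K, hK⟩ := Eval.exists_proj false X h c
    refine ⟨c', fun H => ?_⟩
    obtain ⟨n, hn⟩ := hc (H * K)
    refine ⟨n, fun u ν S hS hG E => ?_⟩
    obtain ⟨a, ha, ht⟩ := hK H u ν S hS E
    exact hn u _ a (by simpa using ht) (hG a ha)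
  lower n := by
    obtain ⟨c, hc⟩ := hφ.lower n
    obtain ⟨c', K, hK⟩ := Eval.exists_lift false X h c
    refine ⟨c', fun u ν S hS hs a ha => ?_⟩
    obtain ⟨E, hE⟩ := hK ⊤ u ν S hS a ha
    exact hc u _ a (by simpa using hE) (hs E)

end Recognition

/-! ### Atomic formulae -/

/-- Values of words for an atomic formula: no marked position, one position marked on the left
or on the right or on both sides (or two positions in this order), or anything else. -/
inductive AtomVal
  | none | left | right | both | bad
  deriving DecidableEq

namespace AtomVal

instance : Fintype AtomVal := ⟨{none, left, right, both, bad}, fun x => by cases x <;> simp⟩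

/-- Concatenation. -/
protected def mul : AtomVal → AtomVal → AtomVal
  | none, x => x
  | x, none => x
  | left, right => both
  | _, _ => bad

instance : SharpMonoid AtomVal where
  mul := AtomVal.mul
  one := none
  mul_assoc := by decide
  one_mul := by decide
  mul_one := by decide
  sharp := id
  mul_sharp := by decide
  sharp_mul := by decide
  sharp_mul_sharp := by decide

theorem mul_eq_none_iff : ∀ x y : AtomVal, x * y = none ↔ x = none ∧ y = none := by decide

theorem mul_eq_right_iff : ∀ x y : AtomVal, x * y = right ↔
    (x = none ∧ y = right) ∨ (x = right ∧ y = none) := by decide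

theorem mul_eq_both_iff : ∀ x y : AtomVal, x * y = both ↔
    (x = none ∧ y = both) ∨ (x = both ∧ y = none) ∨ (x = left ∧ y = right) := by decide

theorem prod_eq_none_iff {n : ℕ} (g : Fin n → AtomVal) :
    (List.ofFn g).prod = none ↔ ∀ i, g i = none := by
  induction n with
  | zero => simp [show (1 : AtomVal) = none from rfl]
  | succ n ih => rw [List.ofFn_succ, List.prod_cons, mul_eq_none_iff, ih, Fin.forall_fin_succ]

theorem prod_eq_right_iff {n : ℕ} (g : Fin n → AtomVal) :
    (List.ofFn g).prod = right ↔ ∃ j, g j = right ∧ ∀ k, k ≠ j → g k = none := by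
  induction n with
  | zero => simp [show (1 : AtomVal) = none from rfl]
  | succ n ih =>
    rw [List.ofFn_succ, List.prod_cons, mul_eq_right_iff, ih, prod_eq_none_iff,
      Fin.exists_fin_succ]
    simp only [Fin.forall_fin_succ, ne_eq, Fin.succ_inj, Fin.succ_ne_zero, not_true_eq_false,
      not_false_eq_true, (Fin.succ_ne_zero _).symm, IsEmpty.forall_iff, true_and, forall_const]
    grind

/-- A `both` arises from a doubly marked position or from `left` before `right`; allowing `i = j`
matches the two positions in the semantics of the order. -/
theorem prod_eq_both_iff {n : ℕ} (g : Fin n → AtomVal) :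
    (List.ofFn g).prod = both ↔ ∃ i j, i ≤ j ∧ (i = j → g i = both) ∧
      (i ≠ j → g i = left ∧ g j = right) ∧ ∀ k, k ≠ i → k ≠ j → g k = none := by
  induction n with
  | zero => simp [show (1 : AtomVal) = none from rfl]
  | succ n ih =>
    rw [List.ofFn_succ, List.prod_cons, mul_eq_both_iff, ih, prod_eq_none_iff, prod_eq_right_iff]
    constructor
    · rintro (⟨h0, i, j, hij, h1, h2, h3⟩ | ⟨h0, h⟩ | ⟨h0, j, h1, h2⟩)
      · refine ⟨i.succ, j.succ, by simpa using hij, fun h => h1 (Fin.succ_inj.1 h),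
          fun h => h2 (fun h' => h (by rw [h'])), Fin.cases (fun _ _ => h0) fun k hk hk' =>
            h3 k (fun h => hk (by rw [h])) fun h => hk' (by rw [h])⟩
      · exact ⟨0, 0, le_rfl, fun _ => h0, fun h => (h rfl).elim,
          Fin.cases (fun h => (h rfl).elim) fun k _ _ => h k⟩
      · exact ⟨0, j.succ, Fin.zero_le _, fun h => (Fin.succ_ne_zero _ h.symm).elim,
          fun _ => ⟨h0, h1⟩, Fin.cases (fun h => (h rfl).elim) fun k _ hk =>
            h2 k fun h => hk (by rw [h])⟩
    · rintro ⟨i, j, hij, h1, h2, h3⟩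
      induction i using Fin.cases with
      | zero =>
        induction j using Fin.cases with
        | zero => exact .inr (.inl ⟨h1 rfl, fun k => h3 k.succ (Fin.succ_ne_zero _)
            (Fin.succ_ne_zero _)⟩)
        | succ j =>
          obtain ⟨h4, h5⟩ := h2 (Fin.succ_ne_zero _).symm
          exact .inr (.inr ⟨h4, j, h5, fun k hk => h3 k.succ (Fin.succ_ne_zero _)
            fun h => hk (Fin.succ_inj.1 h)⟩)
      | succ i =>
        induction j using Fin.cases with
        | zero => simp at hij
        | succ j =>
          exact .inl ⟨h3 0 (Fin.succ_ne_zero _).symm (Fin.succ_ne_zero _).symm, i, j,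
            by simpa using hij, fun h => h1 (by rw [h]), fun h => h2 fun h' => h (Fin.succ_inj.1 h'),
            fun k hk hk' => h3 k.succ (fun h => hk (Fin.succ_inj.1 h))
              fun h => hk' (Fin.succ_inj.1 h)⟩

end AtomVal

section Atoms

variable {A : Type*} [Encodable A]

open scoped Classical in
/-- The value of a letter, marked by the variables in `S`, for an atomic formula. -/
noncomputable def Atom.letterVal : Atom A → A → Set ℕ → AtomVal
  | .incl X Y, _, S => if X ∈ S then (if Y ∈ S then .none else .bad) else .none
  | .le X Y, _, S =>
    if X ∈ S then (if Y ∈ S then .both else .left) else (if Y ∈ S then .right else .none)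
  | .letter a X, b, S =>
    if X ∈ S then (if Encodable.encode b = Encodable.encode a then .both else .bad) else .none

/-- The value of the words that satisfy an atomic formula. -/
def Atom.goal : Atom A → AtomVal
  | .incl _ _ => .none
  | .le _ _ => .both
  | .letter _ _ => .both

theorem Atom.holds_iff (R : Atom A) (u : List A) (ν : Valuation u) :
    R.Holds u ν ↔ (letters R.letterVal u ν).prod = R.goal := by
  classical
  cases R with
  | incl X Y =>
    simp only [Atom.Holds, Atom.goal, letters, AtomVal.prod_eq_none_iff, Atom.letterVal,
      Set.subset_def, Set.mem_ofPred_eq]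
    refine forall_congr' fun i => ?_
    by_cases hX : i ∈ ν X <;> by_cases hY : i ∈ ν Y <;> simp [hX, hY]
  | le X Y =>
    simp only [Atom.Holds, Atom.goal, letters, AtomVal.prod_eq_both_iff, Atom.letterVal,
      Set.mem_ofPred_eq]
    refine exists_congr fun i => exists_congr fun j => ?_
    simp only [Set.ext_iff, Set.mem_singleton_iff]
    constructor
    · rintro ⟨hX, hY, hij⟩
      simp only [hX, hY]
      refine ⟨hij, ?_, ?_, ?_⟩
      · rintro rfl; simp
      · intro h; simp [h, Ne.symm h]
      · intro k h1 h2; simp [h1, h2]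
    · rintro ⟨hij, h1, h2, h3⟩
      refine ⟨fun k => ?_, fun k => ?_, hij⟩
      · by_cases hk : k = i
        · subst hk
          by_cases hkj : k = j
          · have := h1 hkj
            grind
          · have := h2 hkj
            grind
        · by_cases hkj : k = j
          · subst hkj
            have := h2 (Ne.symm hk)
            grind
          · have := h3 k hk hkj
            grind
      · by_cases hk : k = j
        · subst hk
          by_cases hkj : i = k
          · have := h1 hkj
            grind
          · have := h2 hkj
            grind
        · by_cases hkj : k = i
          · subst hkj
            have := h2 hk
            grind
          · have := h3 k hkj hk
            grind
  | letter a X =>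
    simp only [Atom.Holds, Atom.goal, letters, AtomVal.prod_eq_both_iff, Atom.letterVal,
      Set.mem_ofPred_eq, Encodable.encode_inj]
    simp only [Set.ext_iff, Set.mem_singleton_iff]
    constructor
    · rintro ⟨i, hX, hi⟩
      refine ⟨i, i, le_rfl, fun _ => ?_, fun h => (h rfl).elim, fun k hk _ => ?_⟩
      · simpa [hX] using hi
      · simp [hX, hk]
    · rintro ⟨i, j, -, h1, h2, h3⟩
      have hij : i = j := by
        by_contra h
        have := (h2 h).1
        grind
      subst hij
      refine ⟨i, fun k => ?_, ?_⟩
      · have := h1 rfl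
        by_cases hk : k = i
        · grind
        · have := h3 k hk hk
          grind
      · have := h1 rfl
        grind

theorem recognises_pos (R : Atom A) : Recognises (.pos R) R.letterVal {R.goal} :=
  .of_prod (fun _ => rfl) fun u _ ν => R.holds_iff u ν

theorem recognises_neg (R : Atom A) : Recognises (.neg R) R.letterVal {R.goal}ᶜ :=
  .of_prod (fun _ => rfl) fun u _ ν => not_congr (R.holds_iff u ν)

end Atoms

/-! ### The algebra of the cardinality bound -/

/-- Cardinalities up to boundedness. -/
inductive CardVal
  | zero | one | inf
  deriving DecidableEq

namespace CardVal

instance : Fintype CardVal := ⟨{zero, one, inf}, fun x => by cases x <;> simp⟩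

/-- Addition. -/
protected def mul : CardVal → CardVal → CardVal
  | zero, x => x
  | x, zero => x
  | one, one => one
  | _, _ => inf

/-- Long sums. -/
def stab : CardVal → CardVal
  | zero => zero
  | _ => inf

instance : SharpMonoid CardVal where
  mul := CardVal.mul
  one := zero
  mul_assoc := by decide
  one_mul := by decide
  mul_one := by decide
  sharp := stab
  mul_sharp := by decide
  sharp_mul := by decide
  sharp_mul_sharp := by decide

theorem mul_eq_zero_iff : ∀ x y : CardVal, x * y = zero ↔ x = zero ∧ y = zero := by decide

theorem mul_eq_inf_iff : ∀ x y : CardVal, x * y = inf ↔ x = inf ∨ y = inf := by decide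

theorem sharp_eq_zero_iff : ∀ x : CardVal, sharp x = zero ↔ x = zero := by decide

theorem sharp_ne_one : ∀ x : CardVal, sharp x ≠ one := by decide

theorem count_flatten_eq_zero {us : List (List CardVal)} (h : ∀ u ∈ us, u.count one = 0) :
    us.flatten.count one = 0 := by
  rw [List.count_eq_zero]
  intro hmem
  obtain ⟨u, hu, hx⟩ := List.mem_flatten.1 hmem
  exact List.count_eq_zero.1 (h u hu) hx

theorem length_le_count_flatten {us : List (List CardVal)} (h : ∀ u ∈ us, 0 < u.count one) :
    us.length ≤ us.flatten.count one := by
  induction us with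
  | nil => simp
  | cons u us ih =>
    have h1 := h u (by simp)
    have h2 := ih fun v hv => h v (by simp [hv])
    rw [List.length_cons, List.flatten_cons, List.count_append]
    omega

/-- A stabilisation node is worth `zero` or `inf`. Under a value other than `inf`, the occurrences
of `one` are thus combined by binary nodes only, which gives the bound `2 ^ n`. -/
theorem count_le_of_tree {c : ℕ} {H : ℕ∞} {l : List CardVal} {a : CardVal} (h : Tree c H l a) :
    (a = zero → l.count one = 0) ∧ ∀ n : ℕ, H ≤ n → a ≠ inf → l.count one ≤ 2 ^ n := by
  induction h with
  | leaf H a =>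
    refine ⟨fun h => by simp [h], fun n _ _ => ?_⟩
    exact List.count_le_length.trans (by simpa using Nat.one_le_two_pow)
  | @mul H H' u v a b _ _ h₃ i₁ i₂ =>
    refine ⟨fun h => ?_, fun n hn h => ?_⟩
    · obtain ⟨ha, hb⟩ := (mul_eq_zero_iff a b).1 h
      rw [List.count_append, i₁.1 ha, i₂.1 hb]
    · rw [Ne, mul_eq_inf_iff, not_or] at h
      cases n with
      | zero => exact absurd (h₃.trans hn) (by simp)
      | succ n =>
        have hm : H ≤ n := by
          have := h₃.trans hn
          rw [Nat.cast_add, Nat.cast_one] at this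
          exact (ENat.add_le_add_iff_right ENat.one_ne_top).1 this
        have h1 := i₁.2 n hm h.1
        have h2 := i₂.2 n hm h.2
        rw [List.count_append, pow_succ]
        omega
  | @stab H H' us e h₁ h₂ _ h₄ i =>
    have hz : sharp e = zero → us.flatten.count one = 0 := fun h =>
      count_flatten_eq_zero fun u hu => (i u hu).1 ((sharp_eq_zero_iff e).1 h)
    refine ⟨hz, fun n _ h => ?_⟩
    rw [hz]
    · exact Nat.zero_le _
    · have := sharp_ne_one e
      cases hs : sharp e <;> simp_all

/-- Absent from the leaves, `inf` can only originate in a stabilisation node, whose more than `c`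
children each contain a `one`. -/
theorem lt_count_of_tree {c : ℕ} {H : ℕ∞} {l : List CardVal} {a : CardVal} (h : Tree c H l a)
    (hl : ∀ x ∈ l, x ≠ inf) :
    (a ≠ zero → 0 < l.count one) ∧ (a = inf → c < l.count one) := by
  induction h with
  | leaf H a =>
    have := hl a (by simp)
    cases a <;> simp_all
  | @mul H H' u v a b _ _ h₃ i₁ i₂ =>
    have i₁ := i₁ fun x hx => hl x (by simp [hx])
    have i₂ := i₂ fun x hx => hl x (by simp [hx])
    rw [List.count_append]
    refine ⟨fun h => ?_, fun h => ?_⟩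
    · rw [Ne, mul_eq_zero_iff, not_and_or] at h
      rcases h with h | h
      · have := i₁.1 h; omega
      · have := i₂.1 h; omega
    · rcases (mul_eq_inf_iff a b).1 h with h | h
      · have := i₁.2 h; omega
      · have := i₂.2 h; omega
  | @stab H H' us e h₁ h₂ _ h₄ i =>
    have key : sharp e ≠ zero → c < us.flatten.count one := fun h => h₂.trans_le <|
      length_le_count_flatten fun u hu => (i u hu fun x hx => hl x
        (List.mem_flatten.2 ⟨u, hu, hx⟩)).1 fun h' => h ((sharp_eq_zero_iff e).2 h')
    exact ⟨fun h => (Nat.zero_le _).trans_lt (key h), fun h => key (by rw [h]; decide)⟩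

open scoped Classical in
/-- The value of a letter for `|X| ≤ N`. -/
noncomputable def letterVal {A : Type*} (X : ℕ) (_ : A) (S : Set ℕ) : CardVal :=
  if X ∈ S then one else zero

theorem count_letters {A : Type*} (X : ℕ) (u : List A) (ν : Valuation u) :
    ((letters (letterVal X) u ν).count one : ℕ∞) = (ν X).encard := by
  classical
  have : ν X = ((Finset.univ.filter fun i => i ∈ ν X : Finset (Fin u.length)) : Set _) := by
    ext; simp
  conv_rhs => rw [this]
  rw [Set.encard_coe_eq_coe_finsetCard, letters, List.ofFn_eq_map, List.count_eq_countP,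
    List.countP_map, List.countP_eq_length_filter]
  congr 1
  rw [Fin.univ_def]
  simp only [Finset.card, Finset.filter, Multiset.filter_coe, Multiset.coe_card]
  congr 2
  funext i
  by_cases hi : i ∈ ν X <;> simp [letterVal, hi]

theorem recognises {A : Type*} (X : ℕ) :
    Recognises (.cardLe X : Formula A) (letterVal X) {inf}ᶜ where
  upper := by
    refine ⟨0, fun H => ⟨2 ^ H, fun u ν a ha hG => ?_⟩⟩
    change (ν X).encard ≤ _
    rw [← count_letters]
    rcases ha with ⟨h, -⟩ | h
    · simp [h]
    · exact Nat.cast_le.2 ((count_le_of_tree h).2 H le_rfl hG)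
  lower n := by
    refine ⟨n, fun u ν a ha hs => ?_⟩
    change (ν X).encard ≤ _ at hs
    rw [← count_letters, Nat.cast_le] at hs
    rcases ha with ⟨-, rfl⟩ | h
    · simp [show (1 : CardVal) = zero from rfl]
    · intro hinf
      have := (lt_count_of_tree h (by
        intro x hx
        simp only [letters, List.mem_ofFn, letterVal] at hx
        obtain ⟨i, rfl⟩ := hx
        split_ifs <;> simp)).2 hinf
      omega

end CardVal

/-! ### Domination -/

theorem dominated_iff {E : Type*} {f g : E → ℕ∞} :
    Dominated f g ↔ ∀ n : ℕ, ∃ m : ℕ, ∀ x, g x ≤ n → f x ≤ m := by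
  constructor
  · rintro ⟨α, ⟨hα, -⟩, h⟩ n
    refine ⟨α n, fun x hx => (h x).trans ?_⟩
    obtain ⟨k, hk⟩ := ENat.ne_top_iff_exists.1 (ne_top_of_le_ne_top (ENat.natCast_ne_top n) hx)
    rw [← hk] at hx ⊢
    simp only [extend, ENat.recTopCoe_natCast]
    exact Nat.cast_le.2 (hα (Nat.cast_le.1 hx))
  · intro h
    choose m hm using h
    -- Summing makes the function monotone, and the summands `+ 1` make it at least the identity.
    refine ⟨fun n => ∑ i ∈ Finset.range (n + 1), (m i + 1), ⟨?_, fun n => ?_⟩, fun x => ?_⟩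
    · intro a b hab
      exact Finset.sum_le_sum_of_subset (Finset.range_mono (by omega))
    · calc n ≤ ∑ i ∈ Finset.range (n + 1), 1 := by simp
        _ ≤ _ := Finset.sum_le_sum fun i _ => by omega
    · cases hx : g x with
      | top => simp [extend]
      | coe n =>
        simp only [extend, ENat.recTopCoe_natCast]
        refine (hm n x hx.le).trans (Nat.cast_le.2 ?_)
        exact (Nat.le_succ _).trans (Finset.single_le_sum (f := fun i => m i + 1)
          (fun _ _ => Nat.zero_le _) (by simp))

section Domination

variable {A : Type*} {M N : Type} [SharpMonoid M] [SharpMonoid N] [Finite M] [Finite N]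

/-- Domination is a closure property of the recognising algebras. -/
theorem dominated_value_iff {φ ψ : Sentence A} {h : A → Set ℕ → M} {k : A → Set ℕ → N}
    {G : Set M} {G' : Set N} (hφ : Recognises φ.1 h G) (hψ : Recognises ψ.1 k G') :
    Dominated φ.value ψ.value ↔ (1 ∈ G' → 1 ∈ G) ∧
      ∀ b p, Clo (Set.range fun a => (h a ∅, k a ∅)) b p → p.2 ∈ G' → p.1 ∈ G := by
  have hval : ∀ (χ : Sentence A) u (n : ℕ), χ.value u ≤ n ↔ Sat u n χ.1 fun _ => ∅ :=
    fun χ u n => Formula.value_le_iff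
  simp only [dominated_iff, hval]
  constructor
  · intro hdom
    obtain ⟨c, hc⟩ := hψ.upper
    -- A height independent of the threshold is essential: `H` fixes a bound `n` for `ψ`, domination
    -- gives a bound `m` for `φ`, and only then is the threshold `d` chosen.
    have key : ∀ (H : ℕ) (p : M × N), (∀ d, ∃ u, Eval d H
        (letters (fun a S => (h a S, k a S)) u fun _ => ∅) p) → p.2 ∈ G' → p.1 ∈ G := by
      intro H p hp hG'
      obtain ⟨n, hn⟩ := hc H
      obtain ⟨m, hm⟩ := hdom n
      obtain ⟨d, hd⟩ := hφ.lower m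
      obtain ⟨u, hu⟩ := hp (max c d)
      exact hd u _ _ ((hu.letters_fst.anti (le_max_right c d)).mono le_top)
        (hm u (hn u _ _ (hu.letters_snd.anti (le_max_left c d)) hG'))
    refine ⟨fun h1 => key 0 1 (fun d => ⟨[], .inl ⟨rfl, rfl⟩⟩) h1, fun b p hp => ?_⟩
    obtain ⟨H, hH⟩ := hp.exists_tree
    refine key H p fun d => ?_
    obtain ⟨l, hl, ht⟩ := hH d
    obtain ⟨u, rfl⟩ : ∃ u, l = letters (fun a S => (h a S, k a S)) u fun _ => ∅ := by
      have hmem : l ∈ Set.range (List.map fun a => (h a ∅, k a ∅)) := by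
        rw [Set.range_list_map]; exact hl
      obtain ⟨u, rfl⟩ := hmem
      exact ⟨u, (letters_empty (fun a S => (h a S, k a S)) u).symm⟩
    exact ⟨u, .inr ht⟩
  · rintro ⟨h1, hclo⟩ n
    obtain ⟨c, hc⟩ := hψ.lower n
    obtain ⟨d, hd⟩ := hφ.upper
    -- Here the thresholds come before the height, and the bound `m` for `φ` depends on that height.
    obtain ⟨H, hH⟩ := exists_tree (M × N) (max c d)
    obtain ⟨m, hm⟩ := hd H
    refine ⟨m, fun u hu => ?_⟩
    set l := letters (fun a S => (h a S, k a S)) u fun _ => ∅ with hl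
    obtain ⟨p, hp, himp⟩ : ∃ p, Eval (max c d) H l p ∧ (p.2 ∈ G' → p.1 ∈ G) := by
      by_cases hnil : l = []
      · exact ⟨1, .inl ⟨hnil, rfl⟩, h1⟩
      · obtain ⟨p, hp⟩ := hH l hnil
        obtain ⟨b, hb, -⟩ := hp.clo (E := Set.range fun a => (h a ∅, k a ∅)) (by
          intro x hx
          rw [hl, letters_empty] at hx
          obtain ⟨a, -, rfl⟩ := List.mem_map.1 hx
          exact ⟨a, rfl⟩) H le_rfl
        exact ⟨p, .inr hp, hclo b p hb⟩
    refine hm u _ _ (hp.letters_fst.anti (le_max_right c d)) (himp ?_)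
    exact hc u _ _ ((hp.letters_snd.anti (le_max_left c d)).mono le_top) hu

end Domination

/-! ### Bounded quantifiers, bit masks and tables -/

/-- Bounded universal quantification. -/
def allLt (n : ℕ) (f : ℕ → Bool) : Bool := Nat.rec true (fun i b => b && f i) n

/-- Bounded existential quantification. -/
def anyLt (n : ℕ) (f : ℕ → Bool) : Bool := Nat.rec false (fun i b => b || f i) n

/-- The number with the bits `f i`, for `i < n`. -/
def bits (n : ℕ) (f : ℕ → Bool) : ℕ := Nat.rec 0 (fun i r => cond (f i) (2 ^ i + r) r) n

theorem allLt_eq_true {n : ℕ} {f : ℕ → Bool} : allLt n f = true ↔ ∀ i < n, f i = true := by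
  induction n with
  | zero => simp [allLt]
  | succ n ih =>
    change (allLt n f && f n) = true ↔ _
    rw [Bool.and_eq_true, ih, Nat.forall_lt_succ_right]

theorem anyLt_eq_true {n : ℕ} {f : ℕ → Bool} : anyLt n f = true ↔ ∃ i < n, f i = true := by
  induction n with
  | zero => simp [anyLt]
  | succ n ih =>
    change (anyLt n f || f n) = true ↔ _
    rw [Bool.or_eq_true, ih, Nat.exists_lt_succ_right]

theorem bits_lt (n : ℕ) (f : ℕ → Bool) : bits n f < 2 ^ n := by
  induction n with
  | zero => simp [bits]
  | succ n ih =>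
    change cond (f n) (2 ^ n + bits n f) (bits n f) < _
    rw [pow_succ]
    cases f n <;> simp <;> omega

theorem testBit_bits (n : ℕ) (f : ℕ → Bool) (i : ℕ) :
    (bits n f).testBit i = (decide (i < n) && f i) := by
  induction n with
  | zero => simp [bits]
  | succ n ih =>
    change (cond (f n) (2 ^ n + bits n f) (bits n f)).testBit i = _
    have hlt := bits_lt n f
    rcases lt_trichotomy i n with h | rfl | h
    · cases f n
      · simp [ih, h, Nat.lt_succ_of_lt h]
      · rw [cond_true, Nat.testBit_two_pow_add_gt h, ih]
        simp [h, Nat.lt_succ_of_lt h]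
    · cases hf : f i
      · simp [ih]
      · rw [cond_true, Nat.testBit_two_pow_add_eq, ih]
        simp
    · rw [Nat.testBit_lt_two_pow]
      · simp; omega
      · have : 2 ^ (n + 1) ≤ 2 ^ i := Nat.pow_le_pow_right (by norm_num) h
        rw [pow_succ] at this
        cases f n <;> simp <;> omega

theorem testBit_bits_iff {n : ℕ} {f : ℕ → Bool} {i : ℕ} :
    (bits n f).testBit i = true ↔ i < n ∧ f i = true := by
  rw [testBit_bits]; simp

/-- The table of `f`. -/
def tab (n : ℕ) (f : ℕ → ℕ) : List ℕ := (List.range n).map f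

theorem getD_tab {n : ℕ} (f : ℕ → ℕ) {i : ℕ} (hi : i < n) : (tab n f).getD i 0 = f i := by
  simp [tab, List.getD_eq_getElem?_getD, hi]

/-- Finite algebras as tables: size and unit, products, stabilisation, letters, accepting set. -/
abbrev Tables : Type := List (List ℕ)

namespace Tables

/-- An entry of a table. -/
def entry (T : Tables) (i j : ℕ) : ℕ := (T.getD i []).getD j 0

/-- The number of elements. -/
def size (T : Tables) : ℕ := T.entry 0 0

/-- The unit. -/
def unit (T : Tables) : ℕ := T.entry 0 1

/-- Products. -/
def mul (T : Tables) (i j : ℕ) : ℕ := T.entry 1 (i * T.size + j)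

/-- Stabilisation. -/
def stab (T : Tables) (i : ℕ) : ℕ := T.entry 2 i

/-- Values of letters. -/
def letter (T : Tables) (i : ℕ) : ℕ := T.entry 3 i

/-- The accepting set. -/
def good (T : Tables) (i : ℕ) : Bool := T.entry 4 i == 1

/-- Tables from functions. -/
def make (s e L : ℕ) (m : ℕ → ℕ → ℕ) (r l : ℕ → ℕ) (g : ℕ → Bool) : Tables :=
  [[s, e], tab (s * s) fun k => m (k / s) (k % s), tab s r, tab L l,
    tab s fun i => cond (g i) 1 0]

section Make

variable {s e L : ℕ} {m : ℕ → ℕ → ℕ} {r l : ℕ → ℕ} {g : ℕ → Bool} {i j : ℕ}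

theorem mul_make (hi : i < s) (hj : j < s) : (make s e L m r l g).mul i j = m i j := by
  have h : i * s + j < s * s := by nlinarith
  change (tab (s * s) _).getD (i * s + j) 0 = _
  rw [getD_tab _ h, mul_comm i, Nat.mul_add_div (by omega), Nat.div_eq_of_lt hj,
    Nat.mul_add_mod, Nat.mod_eq_of_lt hj, add_zero]

theorem stab_make (hi : i < s) : (make s e L m r l g).stab i = r i := getD_tab _ hi

theorem letter_make (hi : i < L) : (make s e L m r l g).letter i = l i := getD_tab _ hi

theorem good_make (hi : i < s) : (make s e L m r l g).good i = g i := by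
  change ((tab s _).getD i 0 == 1) = _
  rw [getD_tab _ hi]
  cases g i <;> rfl

end Make

/-- `T` holds the operations of `M` in the numbering `c`. -/
structure Codes (T : Tables) {M : Type} [SharpMonoid M] (c : M → ℕ) : Prop where
  inj : Function.Injective c
  lt_size : ∀ x, c x < T.size
  surj : ∀ i < T.size, ∃ x, c x = i
  unit : c 1 = T.unit
  mul : ∀ x y, T.mul (c x) (c y) = c (x * y)
  stab : ∀ x, T.stab (c x) = c (sharp x)

theorem Codes.make {M : Type} [SharpMonoid M] {c : M → ℕ} {s e L : ℕ} {m : ℕ → ℕ → ℕ}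
    {r l : ℕ → ℕ} {g : ℕ → Bool} (inj : Function.Injective c) (lt_size : ∀ x, c x < s)
    (surj : ∀ i < s, ∃ x, c x = i) (unit : c 1 = e) (mul : ∀ x y, m (c x) (c y) = c (x * y))
    (stab : ∀ x, r (c x) = c (sharp x)) : Codes (make s e L m r l g) c where
  inj := inj
  lt_size := lt_size
  surj := surj
  unit := unit
  mul x y := by rw [mul_make (lt_size x) (lt_size y), mul]
  stab x := by rw [stab_make (lt_size x), stab]

/-- `F`, `G` are closed sets of elements, reached from `E` without and with stabilisation. -/
def closed (T : Tables) (E F G : ℕ) : Bool :=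
  allLt T.size fun i =>
    (!E.testBit i || F.testBit i) &&
    ((!((F.testBit i || G.testBit i) && T.mul i i == i) || G.testBit (T.stab i)) &&
    allLt T.size fun j =>
      (!(F.testBit i && F.testBit j) || F.testBit (T.mul i j)) &&
      (!((F.testBit i || G.testBit i) && G.testBit j) || G.testBit (T.mul i j)) &&
      (!(G.testBit i && (F.testBit j || G.testBit j)) || G.testBit (T.mul i j)))

/-- Membership in the closure of `E`. -/
def inClo (q : Bool) (T : Tables) (E k : ℕ) : Bool :=
  allLt (2 ^ T.size) fun F => allLt (2 ^ T.size) fun G =>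
    !T.closed E F G || (!q && F.testBit k) || G.testBit k

theorem Codes.closed_iff {T : Tables} {M : Type} [SharpMonoid M] {c : M → ℕ} (hT : Codes T c)
    {E F G : ℕ} : T.closed E F G = true ↔
      (∀ x, E.testBit (c x) → F.testBit (c x)) ∧
      (∀ x, (F.testBit (c x) ∨ G.testBit (c x)) → x * x = x → G.testBit (c (sharp x))) ∧
      (∀ x y, F.testBit (c x) → F.testBit (c y) → F.testBit (c (x * y))) ∧
      (∀ x y, (F.testBit (c x) ∨ G.testBit (c x)) → G.testBit (c y) → G.testBit (c (x * y))) ∧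
      (∀ x y, G.testBit (c x) → (F.testBit (c y) ∨ G.testBit (c y)) → G.testBit (c (x * y))) := by
  have hall : ∀ p : ℕ → Prop, (∀ i < T.size, p i) ↔ ∀ x, p (c x) := fun p =>
    ⟨fun h x => h _ (hT.lt_size x), fun h i hi => by obtain ⟨x, rfl⟩ := hT.surj i hi; exact h x⟩
  have himp : ∀ a b : Bool, (!a || b) = true ↔ (a = true → b = true) := by decide
  simp only [closed, allLt_eq_true, hall, hT.mul, hT.stab, Bool.and_eq_true, himp,
    Bool.or_eq_true, beq_iff_eq, hT.inj.eq_iff, forall_and, and_imp, and_assoc]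

/-- The elements reached without and with stabilisation form the least closed pair, so a search
through all pairs of masks decides membership. -/
theorem Codes.inClo_iff {T : Tables} {M : Type} [SharpMonoid M] {c : M → ℕ} (hT : Codes T c)
    {q : Bool} {E : ℕ} {x : M} : T.inClo q E (c x) = true ↔
      ∃ b, (q = true → b = true) ∧ Clo {y | E.testBit (c y) = true} b x := by
  classical
  have hspec : T.inClo q E (c x) = true ↔ ∀ F < 2 ^ T.size, ∀ G < 2 ^ T.size,
      T.closed E F G = true →
        (q = false ∧ F.testBit (c x) = true) ∨ G.testBit (c x) = true := by
    simp only [inClo, allLt_eq_true, Bool.or_eq_true, Bool.not_eq_true', Bool.and_eq_true,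
      or_assoc]
    refine forall₂_congr fun F _ => forall₂_congr fun G _ => ?_
    cases T.closed E F G <;> simp
  rw [hspec]
  constructor
  · intro h
    let S : Bool → ℕ := fun b =>
      bits T.size fun i => decide (∃ y, c y = i ∧ Clo {y | E.testBit (c y) = true} b y)
    have hS : ∀ b y, (S b).testBit (c y) = true ↔ Clo {y | E.testBit (c y) = true} b y := by
      intro b y
      rw [testBit_bits_iff]
      simp only [decide_eq_true_eq, hT.inj.eq_iff, exists_eq_left, hT.lt_size, true_and]
    have hclosed : T.closed E (S false) (S true) = true := by
      rw [hT.closed_iff]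
      simp only [hS]
      refine ⟨fun x hx => .base hx, fun x hx he => ?_, fun x y hx hy => ?_, fun x y hx hy => ?_,
        fun x y hx hy => ?_⟩
      · exact hx.elim (fun h => h.stab he) fun h => h.stab he
      · simpa using hx.mul hy
      · rcases hx with hx | hx <;> simpa using hx.mul hy
      · rcases hy with hy | hy <;> simpa using hx.mul hy
    rcases h _ (bits_lt _ _) _ (bits_lt _ _) hclosed with ⟨hq, h⟩ | h
    · exact ⟨false, by simp [hq], (hS _ _).1 h⟩
    · exact ⟨true, by simp, (hS _ _).1 h⟩
  · rintro ⟨b, hb, hx⟩ F - G - hclosed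
    obtain ⟨h₁, h₂, h₃, h₄, h₅⟩ := hT.closed_iff.1 hclosed
    have key : (cond b G F).testBit (c x) = true := by
      clear hb hspec
      induction hx with
      | base hx => exact h₁ _ hx
      | @mul b b' x y _ _ i₁ i₂ =>
        cases b <;> cases b'
        · exact h₃ _ _ i₁ i₂
        · exact h₄ _ _ (.inl i₁) i₂
        · exact h₅ _ _ i₁ (.inl i₂)
        · exact h₄ _ _ (.inr i₁) i₂
      | @stab b x _ he i =>
        cases b
        · exact h₂ _ (.inl i) he
        · exact h₂ _ (.inr i) he
    cases b
    · cases q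
      · exact .inl ⟨rfl, key⟩
      · simp at hb
    · exact .inr key

/-! ### Tables for formulae -/

/-- The product table of `AtomVal`. -/
def atomMul (i j : ℕ) : ℕ :=
  [0, 1, 2, 3, 4, 1, 4, 3, 4, 4, 2, 4, 4, 4, 4, 3, 4, 4, 4, 4, 4, 4, 4, 4, 4].getD (i * 5 + j) 0

/-- The value of the letter `l` with the variables in the mask `S` for the atom with tag `t`. -/
def atomLetter (t x y l S : ℕ) : ℕ :=
  if t % 3 = 0 then cond (S.testBit x) (cond (S.testBit y) 0 4) 0
  else if t % 3 = 1 then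
    cond (S.testBit x) (cond (S.testBit y) 3 1) (cond (S.testBit y) 2 0)
  else cond (S.testBit y) (if l = x then 3 else 4) 0

/-- Tables for literals. -/
def atomTables (V K t x y : ℕ) : Tables :=
  make 5 0 (2 ^ V * K) atomMul (fun i => i) (fun k => atomLetter t x y (k % K) (k / K))
    fun i => (i == if t % 3 = 0 then 0 else 3) == decide (t < 3)

/-- Tables for `|X| ≤ N`. -/
def cardTables (V K x : ℕ) : Tables :=
  make 3 0 (2 ^ V * K) (fun i j => max i j) (fun i => if i = 0 then 0 else 2)
    (fun k => cond ((k / K).testBit x) 1 0) fun i => !(i == 2)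

/-- Tables for conjunctions (`q = false`) and disjunctions (`q = true`). -/
def prodTables (V K : ℕ) (q : Bool) (T U : Tables) : Tables :=
  make (T.size * U.size) (T.unit * U.size + U.unit) (2 ^ V * K)
    (fun i j => T.mul (i / U.size) (j / U.size) * U.size + U.mul (i % U.size) (j % U.size))
    (fun i => T.stab (i / U.size) * U.size + U.stab (i % U.size))
    (fun k => T.letter k * U.size + U.letter k)
    fun i => cond q (T.good (i / U.size) || U.good (i % U.size))
      (T.good (i / U.size) && U.good (i % U.size))

/-- Tables for quantification: existential for `q = true`, universal for `q = false`. -/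
def powTables (V K : ℕ) (q : Bool) (x : ℕ) (T : Tables) : Tables :=
  make (2 ^ T.size) (2 ^ T.unit) (2 ^ V * K)
    (fun E F => bits T.size fun k => anyLt T.size fun i => anyLt T.size fun j =>
      E.testBit i && F.testBit j && T.mul i j == k)
    (fun E => bits T.size fun k => T.inClo q E k)
    (fun n => bits T.size fun k =>
      (k == T.letter ((bits V fun Y => Y == x || (n / K).testBit Y) * K + n % K)) ||
      (k == T.letter ((bits V fun Y => !(Y == x) && (n / K).testBit Y) * K + n % K)))
    fun E => cond q (anyLt T.size fun i => E.testBit i && T.good i)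
      (allLt T.size fun i => !E.testBit i || T.good i)

end Tables

/-! ### Masks of variables and correctness of the tables -/

open scoped Classical in
/-- The mask of the variables below `V` in `S`. -/
noncomputable def mask (V : ℕ) (S : Set ℕ) : ℕ := bits V fun X => decide (X ∈ S)

theorem mask_lt (V : ℕ) (S : Set ℕ) : mask V S < 2 ^ V := bits_lt _ _

theorem testBit_mask {V X : ℕ} (hX : X < V) (S : Set ℕ) :
    (mask V S).testBit X = true ↔ X ∈ S := by
  simp [mask, testBit_bits_iff, hX]

theorem testBit_mask_iff {V X : ℕ} {S : Set ℕ} :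
    (mask V S).testBit X = true ↔ X < V ∧ X ∈ S := by
  simp [mask, testBit_bits_iff]

theorem mask_insert {V : ℕ} (X : ℕ) (S : Set ℕ) :
    (bits V fun Y => Y == X || (mask V S).testBit Y) = mask V (insert X S) := by
  refine Nat.eq_of_testBit_eq fun i => ?_
  rw [Bool.eq_iff_iff, testBit_bits_iff, testBit_mask_iff]
  refine and_congr_right fun hi => ?_
  simp [testBit_mask hi]

theorem mask_diff {V : ℕ} (X : ℕ) (S : Set ℕ) :
    (bits V fun Y => !(Y == X) && (mask V S).testBit Y) = mask V (S \ {X}) := by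
  refine Nat.eq_of_testBit_eq fun i => ?_
  rw [Bool.eq_iff_iff, testBit_bits_iff, testBit_mask_iff]
  refine and_congr_right fun hi => ?_
  simp [testBit_mask hi, and_comm]

section Represents

variable {A : Type*} [Encodable A]

/-- `T` is the algebra `M` with letters `h` and accepting set `G`, for variables below `V` and
letters with codes below `K`. -/
structure Tables.Repr (V K : ℕ) (T : Tables) {M : Type} [SharpMonoid M] (h : A → Set ℕ → M)
    (G : Set M) (c : M → ℕ) : Prop where
  codes : T.Codes c
  letter : ∀ a S, T.letter (mask V S * K + Encodable.encode a) = c (h a S)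
  good : ∀ x, T.good (c x) = true ↔ x ∈ G

variable {V K : ℕ}

theorem letter_index_lt (hK : ∀ a : A, Encodable.encode a < K) (a : A) (S : Set ℕ) :
    mask V S * K + Encodable.encode a < 2 ^ V * K := by
  have := hK a
  have := mask_lt V S
  nlinarith

theorem letter_index_div (hK : ∀ a : A, Encodable.encode a < K) (a : A) (S : Set ℕ) :
    (mask V S * K + Encodable.encode a) / K = mask V S := by
  have := hK a
  rw [mul_comm, Nat.mul_add_div (by omega), Nat.div_eq_of_lt this, add_zero]

theorem letter_index_mod (hK : ∀ a : A, Encodable.encode a < K) (a : A) (S : Set ℕ) :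
    (mask V S * K + Encodable.encode a) % K = Encodable.encode a := by
  rw [mul_comm, Nat.mul_add_mod, Nat.mod_eq_of_lt (hK a)]

/-- The numbering of `AtomVal`. -/
def AtomVal.code : AtomVal → ℕ
  | .none => 0
  | .left => 1
  | .right => 2
  | .both => 3
  | .bad => 4

/-- The numbering of `CardVal`. -/
def CardVal.code : CardVal → ℕ
  | .zero => 0
  | .one => 1
  | .inf => 2

/-- Tags below `3` are positive atoms and the next three their negations, which only complements the
accepting set. For a letter predicate, `x` is the code of the letter and `y` the variable. -/
theorem repr_atomTables (hK : ∀ a : A, Encodable.encode a < K) (R : Atom A) (q : Bool)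
    {t x y : ℕ}
    (hR : R.token (cond q 0 3) = (t, x, y)) (hx : x < V) (hy : y < V) :
    (Tables.atomTables V K t x y).Repr V K R.letterVal (cond q {R.goal} {R.goal}ᶜ)
      AtomVal.code := by
  classical
  refine ⟨.make ?_ ?_ ?_ rfl ?_ ?_, fun a S => ?_, fun v => ?_⟩
  · intro a b; cases a <;> cases b <;> simp [AtomVal.code]
  · intro a; cases a <;> simp [AtomVal.code]
  · intro i hi
    interval_cases i
    exacts [⟨.none, rfl⟩, ⟨.left, rfl⟩, ⟨.right, rfl⟩, ⟨.both, rfl⟩, ⟨.bad, rfl⟩]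
  · intro a b; cases a <;> cases b <;> rfl
  · intro a; rfl
  · rw [Tables.atomTables, Tables.letter_make (letter_index_lt hK a S), letter_index_div hK,
      letter_index_mod hK]
    have hbit : ∀ {X}, X < V → (mask V S).testBit X = decide (X ∈ S) := fun hX => by
      rw [Bool.eq_iff_iff, testBit_mask hX, decide_eq_true_eq]
    cases q <;> cases R <;> simp only [Atom.token, Prod.mk.injEq, cond_true, cond_false] at hR <;>
      obtain ⟨rfl, rfl, rfl⟩ := hR
    all_goals simp only [Tables.atomLetter, hbit hx, hbit hy, Atom.letterVal, Bool.cond_decide]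
    all_goals norm_num
    all_goals split_ifs <;> rfl
  · rw [Tables.atomTables, Tables.good_make (by cases v <;> simp [AtomVal.code])]
    cases q <;> cases R <;> simp only [Atom.token, Prod.mk.injEq, cond_true, cond_false] at hR <;>
      obtain ⟨rfl, rfl, rfl⟩ := hR <;> cases v <;> simp [AtomVal.code, Atom.goal]

theorem repr_cardTables (hK : ∀ a : A, Encodable.encode a < K) {x : ℕ} (hx : x < V) :
    (Tables.cardTables V K x).Repr V K (CardVal.letterVal x : A → Set ℕ → CardVal) {.inf}ᶜ
      CardVal.code := by
  refine ⟨.make ?_ ?_ ?_ rfl ?_ ?_, fun a S => ?_, fun v => ?_⟩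
  · intro a b; cases a <;> cases b <;> simp [CardVal.code]
  · intro a; cases a <;> simp [CardVal.code]
  · intro i hi
    interval_cases i
    exacts [⟨.zero, rfl⟩, ⟨.one, rfl⟩, ⟨.inf, rfl⟩]
  · intro a b; cases a <;> cases b <;> rfl
  · intro a; cases a <;> rfl
  · rw [Tables.cardTables, Tables.letter_make (letter_index_lt hK a S), letter_index_div hK]
    have hx' := testBit_mask hx S
    by_cases h : x ∈ S
    · simp [hx'.2 h, CardVal.letterVal, h, CardVal.code]
    · simp [Bool.eq_false_iff.2 (fun h' => h (hx'.1 h')), CardVal.letterVal, h, CardVal.code]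
  · rw [Tables.cardTables, Tables.good_make (by cases v <;> simp [CardVal.code])]
    cases v <;> simp [CardVal.code]

theorem repr_prodTables (hK : ∀ a : A, Encodable.encode a < K) 
    {M N : Type} [SharpMonoid M] [SharpMonoid N] {h : A → Set ℕ → M}
    {k : A → Set ℕ → N} {G : Set M} {G' : Set N} {c : M → ℕ} {d : N → ℕ} {T U : Tables}
    (hT : T.Repr V K h G c) (hU : U.Repr V K k G' d) (q : Bool) :
    (Tables.prodTables V K q T U).Repr V K (fun a S => (h a S, k a S))
      {p | cond q (p.1 ∈ G ∨ p.2 ∈ G') (p.1 ∈ G ∧ p.2 ∈ G')}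
      fun p => c p.1 * U.size + d p.2 := by
  have hdiv : ∀ x y, (c x * U.size + d y) / U.size = c x := fun x y => by
    have := hU.codes.lt_size y
    rw [mul_comm, Nat.mul_add_div (by omega), Nat.div_eq_of_lt this, add_zero]
  have hmod : ∀ x y, (c x * U.size + d y) % U.size = d y := fun x y => by
    rw [mul_comm, Nat.mul_add_mod, Nat.mod_eq_of_lt (hU.codes.lt_size y)]
  have hlt : ∀ x y, c x * U.size + d y < T.size * U.size := fun x y => by
    have := hU.codes.lt_size y
    have := hT.codes.lt_size x
    nlinarith
  refine ⟨.make ?_ (fun p => hlt _ _) ?_ ?_ ?_ ?_, fun a S => ?_, fun p => ?_⟩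
  · rintro ⟨x, y⟩ ⟨x', y'⟩ hp
    have h1 := congrArg (· / U.size) hp
    have h2 := congrArg (· % U.size) hp
    simp only [hdiv, hmod] at h1 h2
    rw [hT.codes.inj h1, hU.codes.inj h2]
  · intro i hi
    have hpos : 0 < U.size := Nat.pos_of_ne_zero fun h => by simp [h] at hi
    obtain ⟨x, hx⟩ := hT.codes.surj (i / U.size) ((Nat.div_lt_iff_lt_mul hpos).2 hi)
    obtain ⟨y, hy⟩ := hU.codes.surj (i % U.size) (Nat.mod_lt _ hpos)
    exact ⟨(x, y), by rw [hx, hy, mul_comm, Nat.div_add_mod]⟩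
  · rw [Prod.fst_one, Prod.snd_one, hT.codes.unit, hU.codes.unit]
  · intro p p'
    simp only [hdiv, hmod, hT.codes.mul, hU.codes.mul, Prod.fst_mul, Prod.snd_mul]
  · intro p
    simp only [hdiv, hmod, hT.codes.stab, hU.codes.stab]
    rfl
  · rw [Tables.prodTables, Tables.letter_make (letter_index_lt hK a S), hT.letter, hU.letter]
  · rw [Tables.prodTables, Tables.good_make (hlt _ _), hdiv, hmod]
    cases q <;> simp [hT.good, hU.good]

/-- Sets are numbered by the masks of the codes of their elements. Since the numbering of `M` fills
an initial segment, every mask below `2 ^ T.size` is used. -/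
theorem repr_powTables (hK : ∀ a : A, Encodable.encode a < K) 
    {M : Type} [SharpMonoid M] {h : A → Set ℕ → M} {G : Set M} {c : M → ℕ}
    {T : Tables} (hT : T.Repr V K h G c) (q : Bool) (x : ℕ) :
    ∃ d : Pow q M → ℕ, (Tables.powTables V K q x T).Repr V K (projLetter q x h)
      {S | cond q (∃ a ∈ S.carrier, a ∈ G) (∀ a ∈ S.carrier, a ∈ G)} d := by
  classical
  let d : Pow q M → ℕ := fun S => bits T.size fun i => decide (∃ a ∈ S.carrier, c a = i)
  have hd : ∀ (S : Pow q M) a, (d S).testBit (c a) = true ↔ a ∈ S.carrier := fun S a => by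
    rw [testBit_bits_iff]
    simp [hT.codes.lt_size, hT.codes.inj.eq_iff]
  have hbits : ∀ (S : Pow q M) (f : ℕ → Bool), (∀ a, f (c a) = true ↔ a ∈ S.carrier) →
      bits T.size f = d S := fun S f hf => by
    refine Nat.eq_of_testBit_eq fun i => ?_
    rw [Bool.eq_iff_iff, testBit_bits_iff, testBit_bits_iff]
    refine and_congr_right fun hi => ?_
    obtain ⟨a, rfl⟩ := hT.codes.surj i hi
    rw [hf]
    simp [hT.codes.inj.eq_iff]
  have hany : ∀ p : ℕ → Prop, (∃ i < T.size, p i) ↔ ∃ a, p (c a) := fun p =>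
    ⟨fun ⟨i, hi, h⟩ => by obtain ⟨a, rfl⟩ := hT.codes.surj i hi; exact ⟨a, h⟩,
      fun ⟨a, h⟩ => ⟨_, hT.codes.lt_size a, h⟩⟩
  have hall : ∀ p : ℕ → Prop, (∀ i < T.size, p i) ↔ ∀ x, p (c x) := fun p =>
    ⟨fun h x => h _ (hT.codes.lt_size x), fun h i hi => by
      obtain ⟨x, rfl⟩ := hT.codes.surj i hi; exact h x⟩
  refine ⟨d, .make ?_ (fun S => bits_lt _ _) ?_ ?_ ?_ ?_, fun a S => ?_, fun S => ?_⟩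
  · intro S S' hS
    ext a
    rw [← hd S, ← hd S', hS]
  · intro E hE
    refine ⟨⟨{a | E.testBit (c a) = true}⟩, ?_⟩
    rw [← hbits _ (fun i => E.testBit i) fun a => Iff.rfl]
    refine Nat.eq_of_testBit_eq fun i => ?_
    rw [Bool.eq_iff_iff, testBit_bits_iff, and_iff_right_iff_imp]
    intro hi
    by_contra hlt
    rw [Nat.testBit_lt_two_pow (hE.trans_le (Nat.pow_le_pow_right (by norm_num) (by omega)))] at hi
    simp at hi
  · refine Nat.eq_of_testBit_eq fun i => ?_
    rw [Bool.eq_iff_iff, testBit_bits_iff, Nat.testBit_two_pow]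
    simp only [Pow.carrier_one, Set.mem_singleton_iff, exists_eq_left, decide_eq_true_eq,
      ← hT.codes.unit]
    exact ⟨fun h => h.2, fun h => ⟨h ▸ hT.codes.lt_size 1, h⟩⟩
  · intro S S'
    refine hbits _ _ fun a => ?_
    simp only [anyLt_eq_true, hany, Bool.and_eq_true, hd, hT.codes.mul, beq_iff_eq,
      hT.codes.inj.eq_iff, Pow.carrier_mul, Set.mem_image2]
    grind
  · intro S
    refine hbits _ _ fun a => ?_
    rw [hT.codes.inClo_iff, Pow.mem_sharp]
    simp only [hd, Set.ofPred_mem_eq]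
  · rw [Tables.powTables, Tables.letter_make (letter_index_lt hK a S), letter_index_div hK,
      letter_index_mod hK]
    refine hbits _ _ fun b => ?_
    rw [mask_insert, mask_diff, hT.letter, hT.letter]
    simp [projLetter, hT.codes.inj.eq_iff]
  · rw [Tables.powTables, Tables.good_make (show d S < _ from bits_lt _ _)]
    cases q
    · rw [cond_false, allLt_eq_true, hall]
      refine forall_congr' fun a => ?_
      rw [Bool.or_eq_true, Bool.not_eq_true', ← Bool.not_eq_true, hd, hT.good, imp_iff_not_or]
    · rw [cond_true, anyLt_eq_true, hany]
      refine exists_congr fun a => ?_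
      rw [Bool.and_eq_true, hd, hT.good]

end Represents

/-! ### The algorithm -/

/-- One step of the evaluation of a formula in prefix notation, from right to left, with a stack
of tables. -/
def compileStep (V K : ℕ) (t : Token) (st : List Tables) : List Tables :=
  if t.1 < 6 then Tables.atomTables V K t.1 t.2.1 t.2.2 :: st
  else if t.1 = 6 then Tables.cardTables V K t.2.1 :: st
  else if t.1 < 9 then
    Tables.prodTables V K (t.1 == 8) (st.getD 0 []) (st.getD 1 []) :: st.tail.tail
  else Tables.powTables V K (t.1 == 9) t.2.1 (st.getD 0 []) :: st.tail

/-- The tables of a formula. -/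
def compile (V K : ℕ) (ts : List Token) : Tables :=
  (ts.foldr (fun t st => compileStep V K t st) []).getD 0 []

/-- The invariant of the stack machine: reading a formula from right to left pushes exactly its
table on an arbitrary stack. The algebra behind the table is needed for correctness only. -/
theorem exists_recognises {A : Type*} [Encodable A] {V K : ℕ}
    (hK : ∀ a : A, Encodable.encode a < K) (φ : Formula A)
    (hV : ∀ t ∈ φ.code, t.2.1 < V ∧ t.2.2 < V) :
    ∃ T : Tables, (∀ st, φ.code.foldr (fun t st => compileStep V K t st) st = T :: st) ∧
      ∃ (M : Type) (_ : SharpMonoid M) (_ : Finite M) (h : A → Set ℕ → M) (G : Set M)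
        (c : M → ℕ), Recognises φ h G ∧ T.Repr V K h G c := by
  induction φ with
  | pos R =>
    rcases hR : R.token 0 with ⟨t, x, y⟩
    have hV := hV (t, x, y) (by simp [Formula.code, hR])
    have ht : t < 6 := by
      cases R <;> simp only [Atom.token, Prod.mk.injEq] at hR <;> omega
    refine ⟨Tables.atomTables V K t x y, fun st => ?_, AtomVal, inferInstance, inferInstance,
      R.letterVal, {R.goal}, AtomVal.code, recognises_pos R,
      repr_atomTables hK R true hR hV.1 hV.2⟩
    simp [Formula.code, hR, compileStep, ht]
  | neg R =>
    rcases hR : R.token 3 with ⟨t, x, y⟩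
    have hV := hV (t, x, y) (by simp [Formula.code, hR])
    have ht : t < 6 := by
      cases R <;> simp only [Atom.token, Prod.mk.injEq] at hR <;> omega
    refine ⟨Tables.atomTables V K t x y, fun st => ?_, AtomVal, inferInstance, inferInstance,
      R.letterVal, {R.goal}ᶜ, AtomVal.code, recognises_neg R,
      repr_atomTables hK R false hR hV.1 hV.2⟩
    simp [Formula.code, hR, compileStep, ht]
  | cardLe X =>
    have hV := hV (6, X, 0) (by simp [Formula.code])
    exact ⟨Tables.cardTables V K X, fun st => by simp [Formula.code, compileStep], CardVal,
      inferInstance, inferInstance, CardVal.letterVal X, {.inf}ᶜ, CardVal.code,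
      CardVal.recognises X, repr_cardTables hK hV.1⟩
  | and φ ψ i j =>
    obtain ⟨T, hT, M, _, _, h, G, c, hφ, hc⟩ := i fun t ht => hV t (by simp [Formula.code, ht])
    obtain ⟨U, hU, N, _, _, k, G', d, hψ, hd⟩ := j fun t ht => hV t (by simp [Formula.code, ht])
    exact ⟨Tables.prodTables V K false T U, fun st => by
      rw [Formula.code, List.foldr_cons, List.foldr_append, hU, hT]; rfl,
      M × N, inferInstance, inferInstance, _, _, _, hφ.and hψ, repr_prodTables hK hc hd false⟩
  | or φ ψ i j =>
    obtain ⟨T, hT, M, _, _, h, G, c, hφ, hc⟩ := i fun t ht => hV t (by simp [Formula.code, ht])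
    obtain ⟨U, hU, N, _, _, k, G', d, hψ, hd⟩ := j fun t ht => hV t (by simp [Formula.code, ht])
    exact ⟨Tables.prodTables V K true T U, fun st => by
      rw [Formula.code, List.foldr_cons, List.foldr_append, hU, hT]; rfl,
      M × N, inferInstance, inferInstance, _, _, _, hφ.or hψ, repr_prodTables hK hc hd true⟩
  | ex X φ i =>
    obtain ⟨T, hT, M, _, _, h, G, c, hφ, hc⟩ := i fun t ht => hV t (by simp [Formula.code, ht])
    obtain ⟨d, hd⟩ := repr_powTables hK hc true X
    exact ⟨Tables.powTables V K true X T, fun st => by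
      rw [Formula.code, List.foldr_cons, hT]; rfl,
      Pow true M, inferInstance, inferInstance, _, _, d, hφ.ex X, hd⟩
  | all X φ i =>
    obtain ⟨T, hT, M, _, _, h, G, c, hφ, hc⟩ := i fun t ht => hV t (by simp [Formula.code, ht])
    obtain ⟨d, hd⟩ := repr_powTables hK hc false X
    exact ⟨Tables.powTables V K false X T, fun st => by
      rw [Formula.code, List.foldr_cons, hT]; rfl,
      Pow false M, inferInstance, inferInstance, _, _, d, hφ.all X, hd⟩

/-- A strict bound for the parameters of tokens. -/
def tokenBound (ts : List Token) : ℕ := ts.foldr (fun t n => t.2.1 + t.2.2 + n + 1) 0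

theorem lt_tokenBound {ts : List Token} {t : Token} (ht : t ∈ ts) :
    t.2.1 < tokenBound ts ∧ t.2.2 < tokenBound ts := by
  induction ts with
  | nil => simp at ht
  | cons s ts ih =>
    change t.2.1 < s.2.1 + s.2.2 + tokenBound ts + 1 ∧ t.2.2 < s.2.1 + s.2.2 + tokenBound ts + 1
    rcases List.mem_cons.1 ht with rfl | ht
    · omega
    · have := ih ht
      omega

/-- Given tables for both sentences and the codes of the letters, check that the closure of the
letters contains no element that is accepted on the right only. -/
def checkTables (P T U : Tables) (codes : List ℕ) : Bool :=
  (!U.good U.unit || T.good T.unit) &&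
    allLt P.size fun k =>
      !P.inClo false (bits P.size fun i => anyLt codes.length fun j =>
        P.letter (codes.getD j 0) == i) k ||
      (!U.good (k % U.size) || T.good (k / U.size))

/-- The decision procedure for domination, on written formulae. -/
def decideDominated (K : ℕ) (codes : List ℕ) (p : List Token × List Token) : Bool :=
  checkTables
    (Tables.prodTables (tokenBound (p.1 ++ p.2)) K true
      (compile (tokenBound (p.1 ++ p.2)) K p.1) (compile (tokenBound (p.1 ++ p.2)) K p.2))
    (compile (tokenBound (p.1 ++ p.2)) K p.1) (compile (tokenBound (p.1 ++ p.2)) K p.2) codes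

theorem decideDominated_iff {A : Type*} [Encodable A] {K : ℕ} {codes : List ℕ}
    (hK : ∀ a : A, Encodable.encode a < K)
    (hcodes : ∀ n, n ∈ codes ↔ ∃ a : A, Encodable.encode a = n) (φ ψ : Sentence A) :
    decideDominated K codes (φ.1.code, ψ.1.code) = true ↔ Dominated φ.value ψ.value := by
  set V := tokenBound (φ.1.code ++ ψ.1.code) with hV
  obtain ⟨T, hT, M, _, _, h, G, c, hφ, hc⟩ := exists_recognises (V := V) hK φ.1
    fun t ht => lt_tokenBound (by simp [ht])
  obtain ⟨U, hU, N, _, _, k, G', d, hψ, hd⟩ := exists_recognises (V := V) hK ψ.1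
    fun t ht => lt_tokenBound (by simp [ht])
  have hcT : compile V K φ.1.code = T := by rw [compile, hT]; rfl
  have hcU : compile V K ψ.1.code = U := by rw [compile, hU]; rfl
  -- Only the operations and letters of the product matter below; its accepting set, and so the
  -- flag, is immaterial.
  have hP := repr_prodTables hK hc hd true
  -- Sentences are read with no marked position, so the table index of a letter is its code.
  have hmask : mask V ∅ = 0 := by
    refine Nat.eq_of_testBit_eq fun i => ?_
    rw [Bool.eq_iff_iff, testBit_mask_iff]
    simp
  have hdiv : ∀ x y, (c x * U.size + d y) / U.size = c x := fun x y => by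
    have := hd.codes.lt_size y
    rw [mul_comm, Nat.mul_add_div (by omega), Nat.div_eq_of_lt this, add_zero]
  have hmod : ∀ x y, (c x * U.size + d y) % U.size = d y := fun x y => by
    rw [mul_comm, Nat.mul_add_mod, Nat.mod_eq_of_lt (hd.codes.lt_size y)]
  rw [dominated_value_iff hφ hψ, decideDominated]
  dsimp only
  rw [← hV, hcT, hcU]
  set P := Tables.prodTables V K true T U
  set E := bits P.size fun i => anyLt codes.length fun j => P.letter (codes.getD j 0) == i with hE
  have hset : {p : M × N | E.testBit (c p.1 * U.size + d p.2) = true} =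
      Set.range fun a => (h a ∅, k a ∅) := by
    ext p
    have hlet : ∀ a, P.letter (Encodable.encode a) = c (h a ∅) * U.size + d (k a ∅) := fun a => by
      have := hP.letter a ∅
      rwa [hmask, zero_mul, zero_add] at this
    change E.testBit _ = true ↔ _
    rw [hE, testBit_bits_iff, and_iff_right (hP.codes.lt_size p), anyLt_eq_true]
    constructor
    · rintro ⟨j, hj, hjp⟩
      obtain ⟨a, ha⟩ := (hcodes (codes.getD j 0)).1 (by
        rw [List.getD_eq_getElem _ _ hj]; exact List.getElem_mem hj)
      rw [← ha, hlet, beq_iff_eq] at hjp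
      exact ⟨a, hP.codes.inj hjp⟩
    · rintro ⟨a, rfl⟩
      obtain ⟨j, hj, hja⟩ := List.getElem_of_mem ((hcodes _).2 ⟨a, rfl⟩)
      exact ⟨j, hj, by rw [List.getD_eq_getElem _ _ hj, hja, hlet, beq_iff_eq]⟩
  have himp : ∀ a b : Bool, (!a || b) = true ↔ (a = true → b = true) := by decide
  have hall : ∀ p : ℕ → Prop, (∀ i < P.size, p i) ↔ ∀ x : M × N, p (c x.1 * U.size + d x.2) :=
    fun p => ⟨fun h x => h _ (hP.codes.lt_size x), fun h i hi => by
      obtain ⟨x, rfl⟩ := hP.codes.surj i hi; exact h x⟩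
  rw [checkTables, Bool.and_eq_true, himp, ← hc.codes.unit, ← hd.codes.unit, hc.good, hd.good,
    allLt_eq_true, hall]
  refine and_congr_right fun _ => ?_
  simp only [himp, hdiv, hmod, hc.good, hd.good]
  constructor
  · exact fun H b p hp => H p (hP.codes.inClo_iff.2 ⟨b, by simp, hset ▸ hp⟩)
  · intro H p hp
    obtain ⟨b, -, hb⟩ := hP.codes.inClo_iff.1 hp
    exact H b p (hset ▸ hb)

/-! ### The algorithm is primitive recursive -/

section Primrec

variable {α : Type*} [Primcodable α]

theorem primrec_allLt {n : α → ℕ} {f : α → ℕ → Bool} (hn : Primrec n)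
    (hf : Primrec fun p : α × ℕ => f p.1 p.2) : Primrec fun a => allLt (n a) (f a) :=
  Primrec.nat_rec' hn (Primrec.const true) (Primrec.and.comp (Primrec.snd.comp Primrec.snd)
    (hf.comp (Primrec.pair Primrec.fst (Primrec.fst.comp Primrec.snd)))).to₂

theorem primrec_anyLt {n : α → ℕ} {f : α → ℕ → Bool} (hn : Primrec n)
    (hf : Primrec fun p : α × ℕ => f p.1 p.2) : Primrec fun a => anyLt (n a) (f a) :=
  Primrec.nat_rec' hn (Primrec.const false) (Primrec.or.comp (Primrec.snd.comp Primrec.snd)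
    (hf.comp (Primrec.pair Primrec.fst (Primrec.fst.comp Primrec.snd)))).to₂

theorem primrec_pow {f g : α → ℕ} (hf : Primrec f) (hg : Primrec g) :
    Primrec fun a => f a ^ g a :=
  (Primrec₂.unpaired'.1 Nat.Primrec.pow).comp hf hg

theorem primrec_bits {n : α → ℕ} {f : α → ℕ → Bool} (hn : Primrec n)
    (hf : Primrec fun p : α × ℕ => f p.1 p.2) : Primrec fun a => bits (n a) (f a) :=
  Primrec.nat_rec' hn (Primrec.const 0) (Primrec.cond
    (hf.comp (Primrec.pair Primrec.fst (Primrec.fst.comp Primrec.snd)))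
    (Primrec.nat_add.comp (primrec_pow (Primrec.const 2) (Primrec.fst.comp Primrec.snd))
      (Primrec.snd.comp Primrec.snd))
    (Primrec.snd.comp Primrec.snd)).to₂

theorem primrec_tab {n : α → ℕ} {f : α → ℕ → ℕ} (hn : Primrec n)
    (hf : Primrec fun p : α × ℕ => f p.1 p.2) : Primrec fun a => tab (n a) (f a) :=
  Primrec.list_map (Primrec.list_range.comp hn) hf.to₂

theorem primrec_beq {f g : α → ℕ} (hf : Primrec f) (hg : Primrec g) :
    Primrec fun a => f a == g a := Primrec.beq.comp hf hg

theorem primrec_testBit {f g : α → ℕ} (hf : Primrec f) (hg : Primrec g) :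
    Primrec fun a => (f a).testBit (g a) := by
  refine (primrec_beq (Primrec.nat_mod.comp (Primrec.nat_div.comp hf
    (primrec_pow (Primrec.const 2) hg)) (Primrec.const 2)) (Primrec.const 1)).of_eq fun a => ?_
  rw [Nat.testBit_eq_decide_div_mod_eq]
  rfl

theorem primrec_not {f : α → Bool} (hf : Primrec f) : Primrec fun a => !f a := Primrec.not.comp hf

theorem primrec_and {f g : α → Bool} (hf : Primrec f) (hg : Primrec g) :
    Primrec fun a => f a && g a := Primrec.and.comp hf hg

theorem primrec_or {f g : α → Bool} (hf : Primrec f) (hg : Primrec g) :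
    Primrec fun a => f a || g a := Primrec.or.comp hf hg

theorem primrec_add {f g : α → ℕ} (hf : Primrec f) (hg : Primrec g) :
    Primrec fun a => f a + g a := Primrec.nat_add.comp hf hg

theorem primrec_mul {f g : α → ℕ} (hf : Primrec f) (hg : Primrec g) :
    Primrec fun a => f a * g a := Primrec.nat_mul.comp hf hg

theorem primrec_div {f g : α → ℕ} (hf : Primrec f) (hg : Primrec g) :
    Primrec fun a => f a / g a := Primrec.nat_div.comp hf hg

theorem primrec_mod {f g : α → ℕ} (hf : Primrec f) (hg : Primrec g) :
    Primrec fun a => f a % g a := Primrec.nat_mod.comp hf hg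

theorem primrec_max {f g : α → ℕ} (hf : Primrec f) (hg : Primrec g) :
    Primrec fun a => max (f a) (g a) := Primrec.nat_max.comp hf hg

theorem primrec_ite_eq {σ : Type*} [Primcodable σ] {m n : α → ℕ} {f g : α → σ} (hm : Primrec m)
    (hn : Primrec n) (hf : Primrec f) (hg : Primrec g) :
    Primrec fun a => if m a = n a then f a else g a :=
  Primrec.ite (Primrec.eq.comp hm hn) hf hg

theorem primrec_ite_lt {σ : Type*} [Primcodable σ] {m n : α → ℕ} {f g : α → σ} (hm : Primrec m)
    (hn : Primrec n) (hf : Primrec f) (hg : Primrec g) :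
    Primrec fun a => if m a < n a then f a else g a :=
  Primrec.ite (Primrec.nat_lt.comp hm hn) hf hg

theorem primrec_getD {σ : Type*} [Primcodable σ] {f : α → List σ} {g : α → ℕ} (d : σ)
    (hf : Primrec f) (hg : Primrec g) : Primrec fun a => (f a).getD (g a) d :=
  (Primrec.list_getD d).comp hf hg

theorem primrec_cons {σ : Type*} [Primcodable σ] {f : α → σ} {g : α → List σ}
    (hf : Primrec f) (hg : Primrec g) : Primrec fun a => f a :: g a := Primrec.list_cons.comp hf hg

theorem primrec_fst {β γ : Type*} [Primcodable β] [Primcodable γ] {f : α → β × γ}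
    (hf : Primrec f) : Primrec fun a => (f a).1 := Primrec.fst.comp hf

theorem primrec_snd {β γ : Type*} [Primcodable β] [Primcodable γ] {f : α → β × γ}
    (hf : Primrec f) : Primrec fun a => (f a).2 := Primrec.snd.comp hf

theorem primrec_var : Primrec fun a : α => a := Primrec.id

theorem primrec_entry {T : α → Tables} {f g : α → ℕ} (hT : Primrec T) (hf : Primrec f)
    (hg : Primrec g) : Primrec fun a => (T a).entry (f a) (g a) :=
  primrec_getD 0 (primrec_getD [] hT hf) hg

theorem primrec_size {T : α → Tables} (hT : Primrec T) : Primrec fun a => (T a).size :=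
  primrec_entry hT (Primrec.const 0) (Primrec.const 0)

theorem primrec_unit {T : α → Tables} (hT : Primrec T) : Primrec fun a => (T a).unit :=
  primrec_entry hT (Primrec.const 0) (Primrec.const 1)

theorem primrec_tablesMul {T : α → Tables} {f g : α → ℕ} (hT : Primrec T) (hf : Primrec f)
    (hg : Primrec g) : Primrec fun a => (T a).mul (f a) (g a) :=
  primrec_entry hT (Primrec.const 1) (primrec_add (primrec_mul hf (primrec_size hT)) hg)

theorem primrec_stab {T : α → Tables} {f : α → ℕ} (hT : Primrec T) (hf : Primrec f) :
    Primrec fun a => (T a).stab (f a) := primrec_entry hT (Primrec.const 2) hf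

theorem primrec_letter {T : α → Tables} {f : α → ℕ} (hT : Primrec T) (hf : Primrec f) :
    Primrec fun a => (T a).letter (f a) := primrec_entry hT (Primrec.const 3) hf

theorem primrec_good {T : α → Tables} {f : α → ℕ} (hT : Primrec T) (hf : Primrec f) :
    Primrec fun a => (T a).good (f a) :=
  primrec_beq (primrec_entry hT (Primrec.const 4) hf) (Primrec.const 1)

theorem primrec_make {s e L : α → ℕ} {m : α → ℕ → ℕ → ℕ} {r l : α → ℕ → ℕ} {g : α → ℕ → Bool}
    (hs : Primrec s) (he : Primrec e) (hL : Primrec L)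
    (hm : Primrec fun p : α × ℕ => m p.1 (p.2 / s p.1) (p.2 % s p.1))
    (hr : Primrec fun p : α × ℕ => r p.1 p.2) (hl : Primrec fun p : α × ℕ => l p.1 p.2)
    (hg : Primrec fun p : α × ℕ => g p.1 p.2) :
    Primrec fun a => Tables.make (s a) (e a) (L a) (m a) (r a) (l a) (g a) :=
  primrec_cons (primrec_cons hs (primrec_cons he (Primrec.const [])))
    (primrec_cons (primrec_tab (primrec_mul hs hs) hm) (primrec_cons (primrec_tab hs hr)
      (primrec_cons (primrec_tab hL hl) (primrec_cons (primrec_tab hs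
        (Primrec.cond hg (Primrec.const 1) (Primrec.const 0))) (Primrec.const [])))))

theorem primrec_closed {T : α → Tables} {E F G : α → ℕ} (hT : Primrec T) (hE : Primrec E)
    (hF : Primrec F) (hG : Primrec G) : Primrec fun a => (T a).closed (E a) (F a) (G a) := by
  have h : Primrec fun p : Tables × ℕ × ℕ × ℕ => p.1.closed p.2.1 p.2.2.1 p.2.2.2 := by
    unfold Tables.closed
    with_reducible
    repeat' first
      | apply primrec_allLt | apply primrec_and | apply primrec_or | apply primrec_not
      | apply primrec_testBit | apply primrec_beq | apply primrec_tablesMul | apply primrec_stab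
      | apply primrec_size | apply primrec_fst | apply primrec_snd | apply primrec_var
  have h' := h.comp (hT.pair (hE.pair (hF.pair hG)))
  exact h'

theorem primrec_inClo {q : α → Bool} {T : α → Tables} {E k : α → ℕ} (hq : Primrec q)
    (hT : Primrec T) (hE : Primrec E) (hk : Primrec k) :
    Primrec fun a => (T a).inClo (q a) (E a) (k a) := by
  have h : Primrec fun p : Bool × Tables × ℕ × ℕ => p.2.1.inClo p.1 p.2.2.1 p.2.2.2 := by
    unfold Tables.inClo
    with_reducible
    repeat' first
      | apply primrec_allLt | apply primrec_and | apply primrec_or | apply primrec_not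
      | apply primrec_testBit | apply primrec_closed | apply primrec_pow | apply primrec_size
      | apply primrec_fst | apply primrec_snd | apply primrec_var | apply Primrec.const
  have h' := h.comp (hq.pair (hT.pair (hE.pair hk)))
  exact h'

theorem primrec_atomTables {V t x y : α → ℕ} (K : ℕ) (hV : Primrec V) (ht : Primrec t)
    (hx : Primrec x) (hy : Primrec y) :
    Primrec fun a => Tables.atomTables (V a) K (t a) (x a) (y a) := by
  have h : Primrec fun p : ℕ × ℕ × ℕ × ℕ =>
      Tables.atomTables p.1 K p.2.1 p.2.2.1 p.2.2.2 := by
    unfold Tables.atomTables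
    refine primrec_make (Primrec.const 5) (Primrec.const 0)
      (primrec_mul (primrec_pow (Primrec.const 2) Primrec.fst) (Primrec.const K)) ?_ ?_ ?_ ?_
    · unfold Tables.atomMul
      with_reducible
      repeat' first
        | apply primrec_getD | apply primrec_add | apply primrec_mul | apply primrec_div
        | apply primrec_mod | apply primrec_snd | apply primrec_var | apply Primrec.const
    · exact Primrec.snd
    · unfold Tables.atomLetter
      with_reducible
      repeat' first
        | apply primrec_ite_eq | apply Primrec.cond | apply primrec_testBit | apply primrec_div
        | apply primrec_mod | apply primrec_fst | apply primrec_snd | apply primrec_var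
        | apply Primrec.const
    · refine (Primrec.beq (α := Bool)).comp (primrec_beq Primrec.snd (primrec_ite_eq
        (primrec_mod (primrec_fst (primrec_snd Primrec.fst)) (Primrec.const 3)) (Primrec.const 0)
        (Primrec.const 0) (Primrec.const 3))) ?_
      exact PrimrecPred.decide (Primrec.nat_lt.comp (primrec_fst (primrec_snd Primrec.fst))
        (Primrec.const 3))
  have h' := h.comp (hV.pair (ht.pair (hx.pair hy)))
  exact h'

theorem primrec_cardTables {V x : α → ℕ} (K : ℕ) (hV : Primrec V) (hx : Primrec x) :
    Primrec fun a => Tables.cardTables (V a) K (x a) := by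
  have h : Primrec fun p : ℕ × ℕ => Tables.cardTables p.1 K p.2 := by
    unfold Tables.cardTables
    with_reducible
    repeat' first
      | apply primrec_make | apply primrec_ite_eq | apply Primrec.cond | apply primrec_not
      | apply primrec_beq | apply primrec_testBit | apply primrec_max | apply primrec_mul
      | apply primrec_pow | apply primrec_div | apply primrec_mod | apply primrec_fst
      | apply primrec_snd | apply primrec_var | apply Primrec.const
  have h' := h.comp (hV.pair hx)
  exact h'

theorem primrec_prodTables {V : α → ℕ} {q : α → Bool} {T U : α → Tables} (K : ℕ)
    (hV : Primrec V) (hq : Primrec q) (hT : Primrec T) (hU : Primrec U) :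
    Primrec fun a => Tables.prodTables (V a) K (q a) (T a) (U a) := by
  have h : Primrec fun p : ℕ × Bool × Tables × Tables =>
      Tables.prodTables p.1 K p.2.1 p.2.2.1 p.2.2.2 := by
    unfold Tables.prodTables
    with_reducible
    repeat' first
      | apply primrec_make | apply Primrec.cond | apply primrec_or | apply primrec_and
      | apply primrec_good | apply primrec_letter | apply primrec_stab | apply primrec_tablesMul
      | apply primrec_size | apply primrec_unit | apply primrec_add | apply primrec_mul
      | apply primrec_pow | apply primrec_div | apply primrec_mod | apply primrec_fst
      | apply primrec_snd | apply primrec_var | apply Primrec.const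
  have h' := h.comp (hV.pair (hq.pair (hT.pair hU)))
  exact h'

theorem primrec_powTables {V x : α → ℕ} {q : α → Bool} {T : α → Tables} (K : ℕ)
    (hV : Primrec V) (hq : Primrec q) (hx : Primrec x) (hT : Primrec T) :
    Primrec fun a => Tables.powTables (V a) K (q a) (x a) (T a) := by
  have h : Primrec fun p : ℕ × Bool × ℕ × Tables =>
      Tables.powTables p.1 K p.2.1 p.2.2.1 p.2.2.2 := by
    unfold Tables.powTables
    with_reducible
    repeat' first
      | apply primrec_make | apply primrec_bits | apply primrec_anyLt | apply primrec_allLt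
      | apply primrec_inClo | apply Primrec.cond | apply primrec_or | apply primrec_and
      | apply primrec_not | apply primrec_beq | apply primrec_testBit
      | apply primrec_good | apply primrec_letter | apply primrec_tablesMul
      | apply primrec_size | apply primrec_unit | apply primrec_add | apply primrec_mul
      | apply primrec_pow | apply primrec_div | apply primrec_mod | apply primrec_fst
      | apply primrec_snd | apply primrec_var | apply Primrec.const
  have h' := h.comp (hV.pair (hq.pair (hx.pair hT)))
  exact h'

theorem primrec_compile {V : α → ℕ} {ts : α → List Token} (K : ℕ) (hV : Primrec V)
    (hts : Primrec ts) : Primrec fun a => compile (V a) K (ts a) := by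
  refine primrec_getD [] ?_ (Primrec.const 0)
  suffices H : Primrec fun q : α × Token × List Tables => compileStep (V q.1) K q.2.1 q.2.2 from
    Primrec.list_foldr hts (Primrec.const []) H.to₂
  have h : Primrec fun p : ℕ × Token × List Tables => compileStep p.1 K p.2.1 p.2.2 := by
    unfold compileStep
    have htail : ∀ {f : ℕ × Token × List Tables → List Tables}, Primrec f →
        Primrec fun p => (f p).tail := fun hf => Primrec.list_tail.comp hf
    with_reducible
    repeat' first
      | apply primrec_ite_lt | apply primrec_ite_eq | apply primrec_cons | apply htail
      | apply primrec_atomTables | apply primrec_cardTables | apply primrec_prodTables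
      | apply primrec_powTables | apply primrec_getD | apply primrec_beq
      | apply primrec_fst | apply primrec_snd | apply primrec_var | apply Primrec.const
  have h' := h.comp ((hV.comp Primrec.fst).pair Primrec.snd)
  exact h'

theorem primrec_tokenBound {ts : α → List Token} (hts : Primrec ts) :
    Primrec fun a => tokenBound (ts a) := by
  suffices H : Primrec fun q : α × Token × ℕ => q.2.1.2.1 + q.2.1.2.2 + q.2.2 + 1 from
    Primrec.list_foldr hts (Primrec.const 0) H.to₂
  with_reducible
  repeat' first
    | apply primrec_add | apply primrec_fst | apply primrec_snd | apply primrec_var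
    | apply Primrec.const

theorem primrec_checkTables {P T U : α → Tables} (codes : List ℕ) (hP : Primrec P)
    (hT : Primrec T) (hU : Primrec U) :
    Primrec fun a => checkTables (P a) (T a) (U a) codes := by
  have h : Primrec fun p : Tables × Tables × Tables => checkTables p.1 p.2.1 p.2.2 codes := by
    unfold checkTables
    with_reducible
    repeat' first
      | apply primrec_bits | apply primrec_anyLt | apply primrec_allLt
      | apply primrec_inClo | apply primrec_or | apply primrec_and
      | apply primrec_not | apply primrec_beq | apply primrec_getD
      | apply primrec_good | apply primrec_letter | apply primrec_size | apply primrec_unit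
      | apply primrec_div | apply primrec_mod | apply primrec_fst
      | apply primrec_snd | apply primrec_var | apply Primrec.const
  have h' := h.comp (hP.pair (hT.pair hU))
  exact h'

theorem primrec_decideDominated (K : ℕ) (codes : List ℕ) :
    Primrec (decideDominated K codes) := by
  have hV : Primrec fun p : List Token × List Token => tokenBound (p.1 ++ p.2) :=
    primrec_tokenBound Primrec.list_append
  have h₁ := primrec_compile K hV Primrec.fst
  have h₂ := primrec_compile K hV Primrec.snd
  exact primrec_checkTables codes (primrec_prodTables K hV (Primrec.const true) h₁ h₂) h₁ h₂

end Primrec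

/-! ### Reductions to domination -/

section Reductions

variable {A : Type*}

theorem Sentence.value_le_iff {φ : Sentence A} {u : List A} {n : ℕ} :
    φ.value u ≤ n ↔ Sat u n φ.1 fun _ => ∅ := Formula.value_le_iff

/-- All sublevel sets of `g` equal `S`, that is, `g` is `0` on `S` and `∞` elsewhere, so the
quantifier over `n` is void. -/
theorem boundedOver_iff_dominated {E : Type*} {f g : E → ℕ∞} {S : Set E}
    (hg : ∀ (n : ℕ) x, g x ≤ n ↔ x ∈ S) : BoundedOver f S ↔ Dominated f g := by
  simp only [dominated_iff, hg, BoundedOver, forall_const]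

/-- A true sentence. -/
def trueSentence (A : Type*) : Sentence A :=
  ⟨.ex 0 (.pos (.incl 0 0)), by simp [Formula.freeVars, Atom.vars]⟩

theorem trueSentence_value_le (n : ℕ) (u : List A) : (trueSentence A).value u ≤ n :=
  Sentence.value_le_iff.2 ⟨∅, Set.Subset.rfl⟩

theorem Formula.IsMonadic.sat_iff {φ : Formula A} (hφ : φ.IsMonadic) {u : List A} (m n : ℕ)
    {ν : Valuation u} : Sat u m φ ν ↔ Sat u n φ ν := by
  induction φ generalizing ν with
  | pos R => exact Iff.rfl
  | neg R => exact Iff.rfl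
  | cardLe X => exact hφ.elim
  | and φ ψ i j => exact and_congr (i hφ.1) (j hφ.2)
  | or φ ψ i j => exact or_congr (i hφ.1) (j hφ.2)
  | ex X φ i => exact exists_congr fun _ => i hφ
  | all X φ i => exact forall_congr' fun _ => i hφ

/-- Replace `|X| ≤ N` by a true formula with the same free variable. -/
def Formula.relax : Formula A → Formula A
  | .pos R => .pos R
  | .neg R => .neg R
  | .cardLe X => .pos (.incl X X)
  | .and φ ψ => .and φ.relax ψ.relax
  | .or φ ψ => .or φ.relax ψ.relax
  | .ex X φ => .ex X φ.relax
  | .all X φ => .all X φ.relax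

theorem Formula.freeVars_relax (φ : Formula A) : φ.relax.freeVars = φ.freeVars := by
  induction φ <;> simp_all [Formula.relax, Formula.freeVars, Atom.vars]

theorem Formula.sat_relax {φ : Formula A} {u : List A} {m n : ℕ} {ν : Valuation u}
    (h : Sat u m φ ν) : Sat u n φ.relax ν := by
  induction φ generalizing ν with
  | pos R => exact h
  | neg R => exact h
  | cardLe X => exact Set.Subset.rfl
  | and φ ψ i j => exact ⟨i h.1, j h.2⟩
  | or φ ψ i j => exact h.imp i j
  | ex X φ i => exact h.imp fun _ => i
  | all X φ i => exact fun E => i (h E)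

/-- No set of positions exceeds `|u|`, so `N = |u|` satisfies every cardinality bound. Relaxed truth
thus means a finite value. -/
theorem Formula.sat_of_relax {φ : Formula A} {u : List A} {n : ℕ} {ν : Valuation u}
    (h : Sat u n φ.relax ν) : Sat u u.length φ ν := by
  induction φ generalizing ν with
  | pos R => exact h
  | neg R => exact h
  | cardLe X =>
    refine (Set.encard_le_encard (Set.subset_univ (ν X))).trans ?_
    simp [Set.encard_univ]
  | and φ ψ i j => exact ⟨i h.1, j h.2⟩
  | or φ ψ i j => exact h.imp i j
  | ex X φ i => exact h.imp fun _ => i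
  | all X φ i => exact fun E => i (h E)

/-- The relaxation of a sentence. -/
def Sentence.relax (φ : Sentence A) : Sentence A :=
  ⟨φ.1.relax, φ.1.freeVars_relax.trans φ.2⟩

theorem Sentence.relax_value_le_iff (φ : Sentence A) (n : ℕ) (u : List A) :
    φ.relax.value u ≤ n ↔ u ∈ {u | φ.value u ≠ ⊤} := by
  rw [Sentence.value_le_iff]
  constructor
  · intro h
    exact ne_top_of_le_ne_top (ENat.natCast_ne_top u.length)
      (Sentence.value_le_iff.2 (Formula.sat_of_relax h))
  · intro h
    obtain ⟨m, hm⟩ := ENat.ne_top_iff_exists.1 (show φ.value u ≠ ⊤ from h)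
    exact Formula.sat_relax (Sentence.value_le_iff.1 hm.ge)

/-- The effect of relaxation on tokens. -/
def relaxToken (t : Token) : Token := if t.1 = 6 then (0, t.2.1, t.2.1) else t

/-- Each cardinality bound is one token and is replaced by one token, so relaxation is computable on
strings without parsing. -/
theorem Formula.code_relax [Encodable A] (φ : Formula A) :
    φ.relax.code = φ.code.map relaxToken := by
  induction φ with
  | pos R => cases R <;> rfl
  | neg R => cases R <;> rfl
  | cardLe X => rfl
  | and φ ψ i j => simp [Formula.relax, Formula.code, i, j, relaxToken]
  | or φ ψ i j => simp [Formula.relax, Formula.code, i, j, relaxToken]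
  | ex X φ i => simp [Formula.relax, Formula.code, i, relaxToken]
  | all X φ i => simp [Formula.relax, Formula.code, i, relaxToken]

theorem primrec_relaxToken : Primrec relaxToken :=
  primrec_ite_eq Primrec.fst (Primrec.const 6)
    ((Primrec.const 0).pair ((primrec_fst Primrec.snd).pair (primrec_fst Primrec.snd)))
    Primrec.id

/-- A sentence for the length of words. -/
def lengthSentence (A : Type*) : Sentence A :=
  ⟨.ex 0 (.and (.all 1 (.pos (.incl 1 0))) (.cardLe 0)), by
    simp [Formula.freeVars, Atom.vars]⟩

theorem lengthSentence_value_le_iff (n : ℕ) (u : List A) :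
    (lengthSentence A).value u ≤ n ↔ u.length ≤ n := by
  rw [Sentence.value_le_iff]
  have huniv : (Set.univ : Set (Fin u.length)).encard = u.length := by simp [Set.encard_univ]
  constructor
  · rintro ⟨E, hE, hcard⟩
    have hE : E = Set.univ := Set.eq_univ_of_univ_subset (by
      simpa [Sat, Atom.Holds] using hE Set.univ)
    have hle : (Function.update (fun _ => ∅ : Valuation u) 0 E 0).encard ≤ n := hcard
    rw [Function.update_self, hE, huniv] at hle
    exact_mod_cast hle
  · intro h
    refine ⟨Set.univ, fun E => ?_, ?_⟩
    · simp [Sat, Atom.Holds]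
    · change (Function.update (fun _ => ∅ : Valuation u) 0 Set.univ 0).encard ≤ n
      rw [Function.update_self, huniv]
      exact_mod_cast h

/-- Over a finite alphabet a set of words is finite iff its lengths are bounded. -/
theorem diverges_iff_dominated [Finite A] (φ : Sentence A) :
    Diverges φ.value ↔ Dominated (lengthSentence A).value φ.value := by
  rw [dominated_iff]
  refine forall_congr' fun n => ?_
  simp only [lengthSentence_value_le_iff]
  constructor
  · intro h
    obtain ⟨m, hm⟩ := (h.image List.length).bddAbove
    exact ⟨m, fun u hu => hm ⟨u, hu, rfl⟩⟩
  · rintro ⟨m, hm⟩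
    exact (List.finite_length_le A m).subset hm

end Reductions

/-! ### Many-one reductions and the decision problems -/

theorem DecidableProblem.comp {I J C D : Type*} [Primcodable C] [Primcodable D] {code : I → C}
    {P : I → Prop} {code' : J → D} {Q : J → Prop} (h : DecidableProblem code P) (f : J → I)
    (g : D → C) (hg : Computable g) (hcode : ∀ j, code (f j) = g (code' j))
    (hPQ : ∀ j, Q j ↔ P (f j)) : DecidableProblem code' Q := by
  obtain ⟨d, hd, hdP⟩ := h
  exact ⟨fun x => d (g x), hd.comp hg, fun j => by rw [hPQ, ← hdP, hcode]⟩

theorem decidable_dominated (A : Type*) [Finite A] [Encodable A] :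
    DecidableProblem (fun p : Sentence A × Sentence A => (p.1.1.code, p.2.1.code))
      (fun p => Dominated p.1.value p.2.value) := by
  obtain ⟨K, hK⟩ := Finite.exists_le (fun a : A => Encodable.encode a)
  -- The alphabet enters the algorithm through constants: a strict bound for the codes of letters
  -- and the finite list of these codes.
  refine ⟨decideDominated (K + 1) (Set.finite_range (fun a : A => Encodable.encode a)).toFinset.toList,
    (primrec_decideDominated _ _).to_comp, fun p => decideDominated_iff
      (fun a => Nat.lt_succ_of_le (hK a)) (fun n => by simp) p.1 p.2⟩

end CostMSO

theorem theorem2 (A : Type*) [Finite A] [Encodable A] :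
    -- domination: `⟦φ⟧ ≼ ⟦ψ⟧`
    CostMSO.DecidableProblem
        (fun p : CostMSO.Sentence A × CostMSO.Sentence A => (p.1.1.code, p.2.1.code))
        (fun p => CostMSO.Dominated (CostMSO.Sentence.value p.1) (CostMSO.Sentence.value p.2)) ∧
    -- boundedness
    CostMSO.DecidableProblem (fun φ : CostMSO.Sentence A => φ.1.code)
        (fun φ => CostMSO.BoundedOver (CostMSO.Sentence.value φ) Set.univ) ∧
    -- boundedness over a regular language, given by a monadic sentence
    CostMSO.DecidableProblem
        (fun p : CostMSO.Sentence A × CostMSO.MonadicSentence A => (p.1.1.code, p.2.1.code))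
        (fun p => CostMSO.BoundedOver (CostMSO.Sentence.value p.1)
          (CostMSO.MonadicSentence.models p.2)) ∧
    -- limitedness
    CostMSO.DecidableProblem (fun φ : CostMSO.Sentence A => φ.1.code)
        (fun φ => CostMSO.BoundedOver (CostMSO.Sentence.value φ)
          {u | CostMSO.Sentence.value φ u ≠ ⊤}) ∧
    -- divergence
    CostMSO.DecidableProblem (fun φ : CostMSO.Sentence A => φ.1.code)
        (fun φ => CostMSO.Diverges (CostMSO.Sentence.value φ)) := by
  have hdom := CostMSO.decidable_dominated A
  refine ⟨hdom, ?_, ?_, ?_, ?_⟩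
  · refine hdom.comp (fun φ => (φ, CostMSO.trueSentence A))
      (fun c => (c, (CostMSO.trueSentence A).1.code))
      (Computable.id.pair (Computable.const _)) (fun _ => rfl) fun φ => ?_
    exact CostMSO.boundedOver_iff_dominated fun n u =>
      ⟨fun _ => trivial, fun _ => CostMSO.trueSentence_value_le n u⟩
  · refine hdom.comp (fun p => (p.1, ⟨p.2.1, p.2.2.1⟩)) (fun c => c) Computable.id
      (fun _ => rfl) fun p => ?_
    exact CostMSO.boundedOver_iff_dominated fun n u =>
      CostMSO.Sentence.value_le_iff.trans (p.2.2.2.sat_iff n 0)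
  · refine hdom.comp (fun φ => (φ, φ.relax)) (fun c => (c, c.map CostMSO.relaxToken))
      (Primrec.id.pair (Primrec.list_map Primrec.id
        (CostMSO.primrec_relaxToken.comp Primrec.snd).to₂)).to_comp
      (fun φ => by rw [← CostMSO.Formula.code_relax]; rfl) fun φ => ?_
    exact CostMSO.boundedOver_iff_dominated φ.relax_value_le_iff
  · refine hdom.comp (fun φ => (CostMSO.lengthSentence A, φ))
      (fun c => ((CostMSO.lengthSentence A).1.code, c))
      ((Computable.const _).pair Computable.id) (fun _ => rfl) fun φ => ?_
    exact CostMSO.diverges_iff_dominated φ
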